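/- Let $k\ge 1$. A $k$-graph is a countable small category $\Lambda$ with a degree functor $d:\Lambda\to\mathbb{N}^k$ such that whenever $d(\lambda)=m+n$ there are unique morphisms $\mu,\nu$ with $\lambda=\mu\nu$, $d(\mu)=m$, $d(\nu)=n$. Morphisms are called paths, objects are called vertices (and are identified with the identity morphisms), $r(\lambda)$ and $s(\lambda)$ denote the range (codomain) and source (domain) of $\lambda$, and $\mu\nu$ is defined when $s(\mu)=r(\nu)$. $\Lambda$ is row-finite if $v\Lambda^n=\{\lambda: r(\lambda)=v,\ d(\lambda)=n\}$ is finite for every vertex $v$ and every $n\in\mathbb{N}^k$, and strongly connected if for all vertices $v,w$ there is a path with range $v$ and source $w$. Let $\Omega_k$ be the $k$-graph with objects $\mathbb{N}^k$ and exactly one morphism $(p,q)$, of range $p$, source $q$ and degree $q-p$, for each pair $p\le q$. An infinite path $x\in\Lambda^\infty$ is a degree-preserving functor $x:\Omega_k\to\Lambda$. For a row-finite $k$-graph $\Lambda$, a Cuntz--Krieger $\Lambda$-family in a $C^*$-algebra is a family $(t_\lambda)_{\lambda\in\Lambda}$ of partial isometries such that the $t_v$ ($v$ a vertex) are mutually orthogonal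 projections, $t_\lambda t_\eta=t_{\lambda\eta}$ if $s(\lambda)=r(\eta)$, $t_\lambda^*t_\lambda=t_{s(\lambda)}$, and $t_v=\sum_{\lambda\in v\Lambda^n}t_\lambda t_\lambda^*$ for every vertex $v$ and every $n\in\mathbb{N}^k$. The $C^*$-algebra $C^*(\Lambda)$ is the universal $C^*$-algebra generated by a Cuntz--Krieger $\Lambda$-family $(t_\lambda)$. Given $x\in\Lambda^\infty$, for $i\in\mathbb{N}$ put $v_i=x(i,\dots,i)$ and let $x_i=x\big((i,\dots,i),(i+1,\dots,i+1)\big)$, a path of degree $(1,\dots,1)$ with range $v_i$ and source $v_{i+1}$. Let $F_i=\Lambda v_i$ be the set of paths with source $v_i$, let $\{\xi^i_\mu:\mu\in F_i\}$ be the standard orthonormal basis of $\ell^2(F_i)$, let $\rho_i:\ell^2(F_i)\to\ell^2(F_{i+1})$ be the isometry with $\rho_i(\xi^i_\mu)=\xi^{i+1}_{\mu x_i}$, let $\mathcal{H}_x=\varinjlim(\ell^2(F_i),\rho_i)$ be the inductive limit Hilbert space, and let $[\xi^i_\mu]\in\mathcal{H}_x$ be the class of $\xi^i_\mu$. Proposition.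 Let $\Lambda$ be a row-finite, strongly connected $k$-graph and let $x\in\Lambda^\infty$. Then $\mathcal{H}_x$ is separable, and there are unique bounded operators $T_\lambda\in B(\mathcal{H}_x)$, $\lambda\in\Lambda$, such that for all $i\in\mathbb{N}$ and $\mu\in F_i$ $$T_\lambda[\xi^i_\mu]=\begin{cases}[\xi^i_{\lambda\mu}] & \text{if } s(\lambda)=r(\mu),\\ 0 & \text{otherwise.}\end{cases}$$ These operators form a Cuntz--Krieger $\Lambda$-family, and the unique $*$-homomorphism $\pi_x:C^*(\Lambda)\to B(\mathcal{H}_x)$ with $\pi_x(t_\lambda)=T_\lambda$ for all $\lambda\in\Lambda$ is injective. (No aperiodicity assumption on $\Lambda$ is made.) -/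

import Mathlib

open CategoryTheory
open scoped ComplexConjugate

universe u v

/-! ### The free `*`-algebra on a set -/

/-- The free (non-unital, associative, complex) `*`-algebra on a set `X`: finite linear combinations
of nonempty words in the letters `(x, false) = x` and `(x, true) = x*`. -/
def FreeStarAlg (X : Type u) : Type u := MonoidAlgebra ℂ (FreeSemigroup (X × Bool))

namespace FreeStarAlg

variable (X : Type u)

noncomputable instance : NonUnitalRing (FreeStarAlg X) :=
  inferInstanceAs (NonUnitalRing (MonoidAlgebra ℂ (FreeSemigroup (X × Bool))))

noncomputable instance : Module ℂ (FreeStarAlg X) :=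
  inferInstanceAs (Module ℂ (MonoidAlgebra ℂ (FreeSemigroup (X × Bool))))

instance : IsScalarTower ℂ (FreeStarAlg X) (FreeStarAlg X) :=
  inferInstanceAs (IsScalarTower ℂ (MonoidAlgebra ℂ (FreeSemigroup (X × Bool)))
    (MonoidAlgebra ℂ (FreeSemigroup (X × Bool))))

instance : SMulCommClass ℂ (FreeStarAlg X) (FreeStarAlg X) :=
  inferInstanceAs (SMulCommClass ℂ (MonoidAlgebra ℂ (FreeSemigroup (X × Bool)))
    (MonoidAlgebra ℂ (FreeSemigroup (X × Bool))))

variable {X}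

/-- The adjoint of a word: reverse it and exchange `x` and `x*` in every letter. -/
def adjWord : FreeSemigroup (X × Bool) →ₙ* (FreeSemigroup (X × Bool))ᵐᵒᵖ :=
  FreeSemigroup.lift fun p => MulOpposite.op (FreeSemigroup.of (p.1, !p.2))

theorem adjWord_adjWord (w : FreeSemigroup (X × Bool)) :
    (adjWord (adjWord w).unop).unop = w := by
  induction w with
  | ih1 p => simp [adjWord]
  | ih2 p w h1 h2 => rw [map_mul, MulOpposite.unop_mul, map_mul, MulOpposite.unop_mul, h1, h2]

/-- The monomial `c w`. -/
noncomputable def mono (w : FreeSemigroup (X × Bool)) (c : ℂ) : FreeStarAlg X :=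
  MonoidAlgebra.single w c

theorem mono_mul (w w' : FreeSemigroup (X × Bool)) (c c' : ℂ) :
    mono w c * mono w' c' = mono (w * w') (c * c') :=
  MonoidAlgebra.single_mul_single ..

theorem smul_mono (w : FreeSemigroup (X × Bool)) (c c' : ℂ) :
    c • mono w c' = mono w (c * c') :=
  MonoidAlgebra.smul_single ..

@[elab_as_elim]
theorem ind {P : FreeStarAlg X → Prop} (a : FreeStarAlg X)
    (hm : ∀ w c, P (mono w c)) (h0 : P 0) (ha : ∀ a b, P a → P b → P (a + b)) : P a := by
  obtain ⟨f⟩ := a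
  induction f using Finsupp.induction_linear with
  | zero => exact h0
  | add f g hf hg => exact ha _ _ hf hg
  | single w c => exact hm w c

/-- The adjoint `(∑ c_w w)* = ∑ conj(c_w) w*`, on the semigroup algebra. -/
noncomputable def adjAux : MonoidAlgebra ℂ (FreeSemigroup (X × Bool)) →+
    MonoidAlgebra ℂ (FreeSemigroup (X × Bool)) :=
  (Finsupp.liftAddHom fun w : FreeSemigroup (X × Bool) =>
    (MonoidAlgebra.singleAddHom (R := ℂ) (adjWord w).unop).comp
      (starRingEnd ℂ).toAddMonoidHom).comp
    (MonoidAlgebra.coeffAddEquiv (R := ℂ) (M := FreeSemigroup (X × Bool))).toAddMonoidHom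

theorem adjAux_single (w : FreeSemigroup (X × Bool)) (c : ℂ) :
    adjAux (MonoidAlgebra.single w c) = MonoidAlgebra.single (adjWord w).unop (conj c) := by
  simp [adjAux]

/-- The adjoint on the free `*`-algebra. -/
noncomputable def adj : FreeStarAlg X →+ FreeStarAlg X := adjAux

theorem adj_mono (w : FreeSemigroup (X × Bool)) (c : ℂ) :
    adj (mono w c) = mono (adjWord w).unop (conj c) := adjAux_single w c

noncomputable instance : StarRing (FreeStarAlg X) where
  star := adj
  star_involutive a := by
    induction a using ind with
    | hm w c => simp [adj_mono, adjWord_adjWord]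
    | h0 => simp
    | ha a b h1 h2 => rw [map_add, map_add, h1, h2]
  star_add := map_add adj
  star_mul a b := by
    induction a using ind with
    | hm w c =>
      induction b using ind with
      | hm w' c' => simp only [mono_mul, adj_mono, map_mul, MulOpposite.unop_mul, mul_comm]
      | h0 => simp
      | ha a b h1 h2 => rw [mul_add, map_add, map_add, add_mul, h1, h2]
    | h0 => simp
    | ha a b h1 h2 => rw [add_mul, map_add, map_add, mul_add, h1, h2]

theorem star_mono (w : FreeSemigroup (X × Bool)) (c : ℂ) :
    star (mono w c) = mono (adjWord w).unop (conj c) := adj_mono w c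

instance : StarModule ℂ (FreeStarAlg X) where
  star_smul c a := by
    induction a using ind with
    | hm w c' => simp [smul_mono, star_mono]
    | h0 => simp
    | ha a b h1 h2 => rw [smul_add, star_add, star_add, h1, h2, smul_add]

/-- The generator of the free `*`-algebra attached to `x`. -/
noncomputable def gen (x : X) : FreeStarAlg X := mono (FreeSemigroup.of (x, false)) 1

theorem star_gen (x : X) : star (gen x) = mono (FreeSemigroup.of (x, true)) 1 := by
  simp [gen, star_mono, adjWord]

theorem mono_of_true (x : X) : mono (FreeSemigroup.of (x, true)) 1 = star (gen x) :=
  (star_gen x).symm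

theorem hom_ext {A : Type*} [NonUnitalRing A] [StarRing A] [Module ℂ A]
    {φ ψ : FreeStarAlg X →⋆ₙₐ[ℂ] A} (h : ∀ x, φ (gen x) = ψ (gen x)) : φ = ψ := by
  have hof : ∀ p : X × Bool, φ (mono (FreeSemigroup.of p) 1) = ψ (mono (FreeSemigroup.of p) 1) := by
    rintro ⟨x, _ | _⟩
    · exact h x
    · rw [mono_of_true, map_star, map_star, h]
  have hw : ∀ w : FreeSemigroup (X × Bool), φ (mono w 1) = ψ (mono w 1) := fun w => by
    induction w with
    | ih1 p => exact hof p
    | ih2 p w _ hw =>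
      have : mono (FreeSemigroup.of p * w) 1 = mono (FreeSemigroup.of p) 1 * mono w 1 := by
        rw [mono_mul, one_mul]
      rw [this, map_mul, map_mul, hof, hw]
  ext a
  induction a using ind with
  | hm w c =>
    have : mono w c = c • mono w 1 := by rw [smul_mono, mul_one]
    rw [this, map_smul, map_smul, hw]
  | h0 => rw [map_zero, map_zero]
  | ha a b h1 h2 => rw [map_add, map_add, h1, h2]

theorem exists_lift {A : Type*} [NonUnitalRing A] [StarRing A] [Module ℂ A] [IsScalarTower ℂ A A]
    [SMulCommClass ℂ A A] [StarModule ℂ A] (s : X → A) :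
    ∃ φ : FreeStarAlg X →⋆ₙₐ[ℂ] A, ∀ x, φ (gen x) = s x := by
  let σ : FreeSemigroup (X × Bool) →ₙ* A :=
    FreeSemigroup.lift fun p => if p.2 then star (s p.1) else s p.1
  have hσ : ∀ w, σ (adjWord w).unop = star (σ w) := fun w => by
    induction w with
    | ih1 p => rcases p with ⟨x, _ | _⟩ <;> simp [σ, adjWord]
    | ih2 p w h1 h2 => rw [map_mul, MulOpposite.unop_mul, map_mul, map_mul, h1, h2, star_mul]
  let φ₀ : MonoidAlgebra ℂ (FreeSemigroup (X × Bool)) →ₙₐ[ℂ] A := MonoidAlgebra.liftMagma ℂ σ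
  let φ : FreeStarAlg X →ₙₐ[ℂ] A := φ₀
  have hφ : ∀ w c, φ (mono w c) = c • σ w := fun w c => by
    change φ₀ (MonoidAlgebra.single w c) = _
    simp [φ₀]
  refine ⟨{ φ with map_star' := fun a => ?_ }, fun x => ?_⟩
  · change φ (star a) = star (φ a)
    induction a using ind with
    | hm w c => rw [star_mono, hφ, hφ, hσ, star_smul]; rfl
    | h0 => rw [star_zero, map_zero, star_zero]
    | ha a b h1 h2 => rw [star_add, map_add, map_add, star_add, h1, h2]
  · change φ (mono _ 1) = s x
    rw [hφ, one_smul]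
    simp [σ]

end FreeStarAlg

/-! ### `C*`-seminorms and the `C*`-algebra obtained from one by separation and completion -/

section CStarSeminorm

variable (F : Type u) [NonUnitalRing F] [StarRing F] [Module ℂ F]

/-- A `C*`-seminorm on a complex `*`-algebra. -/
structure CStarSeminorm extends Seminorm ℂ F where
  mul_le' : ∀ a b, toFun (a * b) ≤ toFun a * toFun b
  star_mul_self' : ∀ a, toFun (star a * a) = toFun a ^ 2

variable {F}

namespace CStarSeminorm

instance : FunLike (CStarSeminorm F) F ℝ where
  coe N := N.toFun
  coe_injective := by
    rintro ⟨p, _, _⟩ ⟨q, _, _⟩ h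
    have : p = q := DFunLike.coe_injective h
    subst this; rfl

instance : SeminormClass (CStarSeminorm F) ℂ F where
  map_zero N := map_zero N.toSeminorm
  map_add_le_add N := map_add_le_add N.toSeminorm
  map_neg_eq_map N := map_neg_eq_map N.toSeminorm
  map_smul_eq_mul N := map_smul_eq_mul N.toSeminorm

theorem mul_le (N : CStarSeminorm F) (a b : F) : N (a * b) ≤ N a * N b := N.mul_le' a b

theorem star_mul_self (N : CStarSeminorm F) (a : F) : N (star a * a) = N a ^ 2 :=
  N.star_mul_self' a

theorem star_eq (N : CStarSeminorm F) (a : F) : N (star a) = N a := by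
  have key : ∀ b, N b ≤ N (star b) := fun b => by
    have h := (N.star_mul_self b).symm.le.trans (N.mul_le _ _)
    rcases (apply_nonneg N b).eq_or_lt with h0 | h0
    · rw [← h0]; exact apply_nonneg N _
    · rw [sq] at h; exact le_of_mul_le_mul_right h h0
  exact le_antisymm (by simpa using key (star a)) (key a)

/-- The zero seminorm. -/
noncomputable def zero : CStarSeminorm F := { (0 : Seminorm ℂ F) with
  mul_le' := fun a b => by
    show (0 : ℝ) ≤ 0 * 0
    simp
  star_mul_self' := fun a => by
    show (0 : ℝ) = 0 ^ 2
    simp }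

/-- The pointwise supremum of a nonempty, pointwise bounded set of `C*`-seminorms. -/
noncomputable def sup (S : Set (CStarSeminorm F)) (hne : S.Nonempty)
    (hbd : ∀ a, BddAbove (Set.range fun N : S => N.1 a)) : CStarSeminorm F :=
  haveI : Nonempty S := hne.to_subtype
  { toFun := fun a => ⨆ N : S, N.1 a
    map_zero' := by simp
    add_le' := fun a b => ciSup_le fun N => (map_add_le_add N.1 a b).trans
      (add_le_add (le_ciSup (hbd a) N) (le_ciSup (hbd b) N))
    neg' := fun a => by simp
    smul' := fun c a => by
      simp only [map_smul_eq_mul]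
      exact (Real.mul_iSup_of_nonneg (norm_nonneg c) _).symm
    mul_le' := fun a b => ciSup_le fun N => (N.1.mul_le a b).trans
      (mul_le_mul (le_ciSup (hbd a) N) (le_ciSup (hbd b) N) (apply_nonneg _ _)
        ((apply_nonneg N.1 a).trans (le_ciSup (hbd a) N)))
    star_mul_self' := fun a => by
      simp only [star_mul_self]
      refine le_antisymm (ciSup_le fun N => ?_) ?_
      · exact pow_le_pow_left₀ (apply_nonneg _ _) (le_ciSup (hbd a) N) 2
      · have hb : BddAbove (Set.range fun N : S => N.1 a ^ 2) := by
          obtain ⟨M, hM⟩ := hbd a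
          refine ⟨M ^ 2, ?_⟩
          rintro _ ⟨N, rfl⟩
          exact pow_le_pow_left₀ (apply_nonneg _ _) (hM ⟨N, rfl⟩) 2
        have h0 : 0 ≤ ⨆ N : S, N.1 a ^ 2 := Real.iSup_nonneg fun N => by positivity
        have h1 : (⨆ N : S, N.1 a) ≤ √(⨆ N : S, N.1 a ^ 2) :=
          ciSup_le fun N => Real.le_sqrt_of_sq_le (le_ciSup hb N)
        calc (⨆ N : S, N.1 a) ^ 2 ≤ √(⨆ N : S, N.1 a ^ 2) ^ 2 :=
              pow_le_pow_left₀ (Real.iSup_nonneg fun N => apply_nonneg _ _) h1 2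
          _ = ⨆ N : S, N.1 a ^ 2 := Real.sq_sqrt h0 }

theorem le_sup {S : Set (CStarSeminorm F)} (hne : S.Nonempty)
    (hbd : ∀ a, BddAbove (Set.range fun N : S => N.1 a)) {N : CStarSeminorm F} (hN : N ∈ S)
    (a : F) : N a ≤ sup S hne hbd a :=
  le_ciSup (hbd a) ⟨N, hN⟩

theorem dist_aux (N : CStarSeminorm F) : (∀ a, N (-a + a) = 0) ∧
    (∀ a b, N (-a + b) = N (-b + a)) ∧ ∀ a b c, N (-a + c) ≤ N (-a + b) + N (-b + c) := by
  refine ⟨fun a => by simp, fun a b => ?_, fun a b c => ?_⟩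
  · rw [← map_neg_eq_map N (-a + b)]; simp
  · have h : -a + c = (-a + b) + (-b + c) := by abel
    rw [h]; exact map_add_le_add N _ _

/-- The `C*`-seminorm `a ↦ ‖φ a‖` defined by a `*`-homomorphism into a `C*`-algebra. -/
noncomputable def comap {A : Type*} [NonUnitalCStarAlgebra A] (φ : F →⋆ₙₐ[ℂ] A) :
    CStarSeminorm F where
  toFun a := ‖φ a‖
  map_zero' := by simp
  add_le' a b := by rw [map_add]; exact norm_add_le _ _
  neg' a := by simp
  smul' c a := by rw [map_smul, norm_smul]
  mul_le' a b := by rw [map_mul]; exact norm_mul_le _ _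
  star_mul_self' a := by rw [map_mul, map_star, CStarRing.norm_star_mul_self, sq]

/-- The `*`-algebra `F`, regarded as a seminormed `*`-algebra by means of `N`. -/
def Pre (_N : CStarSeminorm F) : Type u := F

section Pre

variable (N : CStarSeminorm F)

noncomputable instance : NonUnitalRing N.Pre := inferInstanceAs (NonUnitalRing F)

noncomputable instance : NonUnitalSeminormedRing N.Pre where
  __ := (inferInstance : NonUnitalRing N.Pre)
  norm := (N : F → ℝ)
  dist := fun a b : F => N (-a + b)
  dist_self := N.dist_aux.1
  dist_comm := N.dist_aux.2.1
  dist_triangle := N.dist_aux.2.2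
  dist_eq _ _ := rfl
  norm_mul_le := N.mul_le

theorem norm_pre (a : N.Pre) : ‖a‖ = N (show F from a) := rfl

noncomputable instance : StarRing N.Pre := inferInstanceAs (StarRing F)
noncomputable instance : Module ℂ N.Pre := inferInstanceAs (Module ℂ F)
instance [IsScalarTower ℂ F F] : IsScalarTower ℂ N.Pre N.Pre :=
  inferInstanceAs (IsScalarTower ℂ F F)
instance [SMulCommClass ℂ F F] : SMulCommClass ℂ N.Pre N.Pre :=
  inferInstanceAs (SMulCommClass ℂ F F)
instance [StarModule ℂ F] : StarModule ℂ N.Pre :=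
  inferInstanceAs (StarModule ℂ F)

noncomputable instance : NormedSpace ℂ N.Pre where
  __ := (inferInstance : Module ℂ N.Pre)
  norm_smul_le c a := (map_smul_eq_mul N c (show F from a)).le

instance : NormedStarGroup N.Pre where
  norm_star_le a := (N.star_eq (show F from a)).le

/-- The separated completion of `F` with respect to the `C*`-seminorm `N`. -/
def Envelope : Type u := UniformSpace.Completion N.Pre

namespace Envelope

noncomputable instance : NormedAddCommGroup N.Envelope :=
  inferInstanceAs (NormedAddCommGroup (UniformSpace.Completion N.Pre))
noncomputable instance : NormedSpace ℂ N.Envelope :=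
  inferInstanceAs (NormedSpace ℂ (UniformSpace.Completion N.Pre))
instance : CompleteSpace N.Envelope :=
  inferInstanceAs (CompleteSpace (UniformSpace.Completion N.Pre))

variable {N}

/-- The canonical map of `F` into its completion. -/
noncomputable def ι (a : F) : N.Envelope := UniformSpace.Completion.coe' (α := N.Pre) a

theorem ι_add (a b : F) : (ι (a + b) : N.Envelope) = ι a + ι b :=
  UniformSpace.Completion.coe_add (α := N.Pre) a b
theorem ι_smul (c : ℂ) (a : F) : (ι (c • a) : N.Envelope) = c • ι a :=
  UniformSpace.Completion.coe_smul (X := N.Pre) c a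
theorem ι_zero : (ι 0 : N.Envelope) = 0 := UniformSpace.Completion.coe_zero (α := N.Pre)
theorem norm_ι (a : F) : ‖(ι a : N.Envelope)‖ = N a := UniformSpace.Completion.norm_coe (E := N.Pre) a
theorem denseRange_ι : DenseRange (ι : F → N.Envelope) :=
  UniformSpace.Completion.denseRange_coe (α := N.Pre)

@[elab_as_elim]
theorem ind {P : N.Envelope → Prop} (a : N.Envelope) (hc : IsClosed {a | P a})
    (h : ∀ a : F, P (ι a)) : P a :=
  UniformSpace.Completion.induction_on (α := N.Pre) a hc h

noncomputable instance : Mul N.Envelope where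
  mul a b := (UniformSpace.Completion.isDenseInducing_coe (α := N.Pre)).prodMap
    (UniformSpace.Completion.isDenseInducing_coe (α := N.Pre)) |>.extend
    (fun p : N.Pre × N.Pre => (ι (p.1 * p.2 : N.Pre) : N.Envelope)) (a, b)

theorem ι_mul (a b : F) : (ι (a * b) : N.Envelope) = ι a * ι b :=
  ((UniformSpace.Completion.isDenseInducing_coe (α := N.Pre)).prodMap
    (UniformSpace.Completion.isDenseInducing_coe (α := N.Pre)) |>.extend_eq
      ((UniformSpace.Completion.continuous_coe N.Pre).comp
        (continuous_mul (M := N.Pre))) (a, b)).symm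

instance : ContinuousMul N.Envelope where
  continuous_mul := by
    let m := (AddMonoidHom.mul : N.Pre →+ N.Pre →+ N.Pre).compr₂ UniformSpace.Completion.toCompl
    have : Continuous fun p : N.Pre × N.Pre => m p.1 p.2 :=
      (UniformSpace.Completion.continuous_coe N.Pre).comp (continuous_mul (M := N.Pre))
    have di : IsDenseInducing (UniformSpace.Completion.toCompl : N.Pre → UniformSpace.Completion N.Pre) :=
      UniformSpace.Completion.isDenseInducing_coe
    exact (di.extend_Z_bilin di this :)

noncomputable instance : Star N.Envelope where
  star := UniformSpace.Completion.map (star : N.Pre → N.Pre)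

theorem ι_star (a : F) : (ι (star a) : N.Envelope) = star (ι a) :=
  (UniformSpace.Completion.map_coe (α := N.Pre) (β := N.Pre)
    (star_isometry (E := N.Pre)).uniformContinuous a).symm

theorem continuous_star' : Continuous (star : N.Envelope → N.Envelope) :=
  UniformSpace.Completion.continuous_map (α := N.Pre) (β := N.Pre)

theorem ext₁ {f g : N.Envelope → N.Envelope} (hf : Continuous f) (hg : Continuous g)
    (h : ∀ a : F, f (ι a) = g (ι a)) (a : N.Envelope) : f a = g a :=
  ind a (isClosed_eq hf hg) h

theorem add_mul_aux (a b c : N.Envelope) : (a + b) * c = a * c + b * c := by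
  refine ext₁ (f := fun a => (a + b) * c) (g := fun a => a * c + b * c)
    (by fun_prop) (by fun_prop) (fun a => ?_) a
  refine ext₁ (f := fun b => (ι a + b) * c) (g := fun b => ι a * c + b * c)
    (by fun_prop) (by fun_prop) (fun b => ?_) b
  refine ext₁ (f := fun c => (ι a + ι b) * c) (g := fun c => ι a * c + ι b * c)
    (by fun_prop) (by fun_prop) (fun c => ?_) c
  simp only [← ι_add, ← ι_mul, add_mul]

theorem mul_add_aux (a b c : N.Envelope) : a * (b + c) = a * b + a * c := by
  refine ext₁ (f := fun a => a * (b + c)) (g := fun a => a * b + a * c)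
    (by fun_prop) (by fun_prop) (fun a => ?_) a
  refine ext₁ (f := fun b => ι a * (b + c)) (g := fun b => ι a * b + ι a * c)
    (by fun_prop) (by fun_prop) (fun b => ?_) b
  refine ext₁ (f := fun c => ι a * (ι b + c)) (g := fun c => ι a * ι b + ι a * c)
    (by fun_prop) (by fun_prop) (fun c => ?_) c
  simp only [← ι_add, ← ι_mul, mul_add]

theorem mul_assoc_aux (a b c : N.Envelope) : (a * b) * c = a * (b * c) := by
  refine ext₁ (f := fun a => (a * b) * c) (g := fun a => a * (b * c))
    ((continuous_id.mul continuous_const).mul continuous_const)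
    (continuous_id.mul continuous_const) (fun a => ?_) a
  refine ext₁ (f := fun b => (ι a * b) * c) (g := fun b => ι a * (b * c))
    ((continuous_const.mul continuous_id).mul continuous_const)
    (continuous_const.mul (continuous_id.mul continuous_const)) (fun b => ?_) b
  refine ext₁ (f := fun c => (ι a * ι b) * c) (g := fun c => ι a * (ι b * c))
    (continuous_const.mul continuous_id)
    (continuous_const.mul (continuous_const.mul continuous_id)) (fun c => ?_) c
  simp only [← ι_mul, mul_assoc]

theorem zero_mul_aux (a : N.Envelope) : 0 * a = 0 := by
  refine ext₁ (f := fun a => 0 * a) (g := fun _ => 0) (continuous_const.mul continuous_id) continuous_const (fun a => ?_) a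
  simp only [← ι_zero, ← ι_mul, zero_mul]

theorem mul_zero_aux (a : N.Envelope) : a * 0 = 0 := by
  refine ext₁ (f := fun a => a * 0) (g := fun _ => 0) (continuous_id.mul continuous_const) continuous_const (fun a => ?_) a
  simp only [← ι_zero, ← ι_mul, mul_zero]

theorem norm_mul_le_aux (a b : N.Envelope) : ‖a * b‖ ≤ ‖a‖ * ‖b‖ := by
  refine ind (P := fun a => ‖a * b‖ ≤ ‖a‖ * ‖b‖) a
    (isClosed_le (by fun_prop) (by fun_prop)) (fun a => ?_)
  refine ind (P := fun b => ‖ι a * b‖ ≤ ‖ι a‖ * ‖b‖) b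
    (isClosed_le (by fun_prop) (by fun_prop)) (fun b => ?_)
  simp only [← ι_mul, norm_ι]
  exact N.mul_le a b

theorem star_star_aux (a : N.Envelope) : star (star a) = a :=
  ext₁ (f := fun a => star (star a)) (g := fun a => a) (continuous_star'.comp continuous_star')
    continuous_id (fun a => by simp only [← ι_star, star_star]) a

theorem star_mul_aux (a b : N.Envelope) : star (a * b) = star b * star a := by
  refine ext₁ (f := fun a => star (a * b)) (g := fun a => star b * star a)
    (continuous_star'.comp (by fun_prop)) (continuous_const.mul continuous_star') (fun a => ?_) a
  refine ext₁ (f := fun b => star (ι a * b)) (g := fun b => star b * star (ι a))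
    (continuous_star'.comp (by fun_prop)) (continuous_star'.mul continuous_const) (fun b => ?_) b
  simp only [← ι_star, ← ι_mul, star_mul]

theorem star_add_aux (a b : N.Envelope) : star (a + b) = star a + star b := by
  refine ext₁ (f := fun a => star (a + b)) (g := fun a => star a + star b)
    (continuous_star'.comp (by fun_prop)) (continuous_star'.add continuous_const) (fun a => ?_) a
  refine ext₁ (f := fun b => star (ι a + b)) (g := fun b => star (ι a) + star b)
    (continuous_star'.comp (by fun_prop)) (continuous_const.add continuous_star') (fun b => ?_) b
  simp only [← ι_star, ← ι_add, star_add]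

theorem norm_star_mul_self_aux (a : N.Envelope) : ‖a‖ * ‖a‖ ≤ ‖star a * a‖ := by
  refine ind (P := fun a => ‖a‖ * ‖a‖ ≤ ‖star a * a‖) a (isClosed_le (by fun_prop)
    (continuous_norm.comp (continuous_star'.mul continuous_id))) (fun a => ?_)
  simp only [← ι_star, ← ι_mul, norm_ι, star_mul_self, sq, le_refl]

theorem smul_mul_aux [IsScalarTower ℂ F F] (c : ℂ) (a b : N.Envelope) :
    (c • a) * b = c • (a * b) := by
  refine ext₁ (f := fun a => (c • a) * b) (g := fun a => c • (a * b))
    ((continuous_id.const_smul c).mul continuous_const)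
    ((continuous_id.mul continuous_const).const_smul c) (fun a => ?_) a
  refine ext₁ (f := fun b => (c • ι a) * b) (g := fun b => c • (ι a * b))
    (continuous_const.mul continuous_id) ((continuous_const.mul continuous_id).const_smul c) (fun b => ?_) b
  simp only [← ι_smul, ← ι_mul, smul_mul_assoc]

theorem mul_smul_aux [SMulCommClass ℂ F F] (c : ℂ) (a b : N.Envelope) :
    c • (a * b) = a * (c • b) := by
  refine ext₁ (f := fun a => c • (a * b)) (g := fun a => a * (c • b))
    ((continuous_id.mul continuous_const).const_smul c) (continuous_id.mul continuous_const) (fun a => ?_) a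
  refine ext₁ (f := fun b => c • (ι a * b)) (g := fun b => ι a * (c • b))
    ((continuous_const.mul continuous_id).const_smul c)
    (continuous_const.mul (continuous_id.const_smul c)) (fun b => ?_) b
  simp only [← ι_smul, ← ι_mul, mul_smul_comm]

theorem star_smul_aux [StarModule ℂ F] (c : ℂ) (a : N.Envelope) :
    star (c • a) = star c • star a :=
  ext₁ (f := fun a => star (c • a)) (g := fun a => star c • star a)
    (continuous_star'.comp (continuous_id.const_smul c)) ((continuous_const_smul (star c)).comp continuous_star')
    (fun a => by simp only [← ι_star, ← ι_smul, star_smul]) a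

noncomputable instance : NonUnitalNormedRing N.Envelope where
  __ := (inferInstance : NormedAddCommGroup N.Envelope)
  __ := (inferInstance : Mul N.Envelope)
  left_distrib := mul_add_aux
  right_distrib := add_mul_aux
  zero_mul := zero_mul_aux
  mul_zero := mul_zero_aux
  mul_assoc := mul_assoc_aux
  norm_mul_le := norm_mul_le_aux

noncomputable instance : StarRing N.Envelope where
  star_involutive := star_star_aux
  star_mul := star_mul_aux
  star_add := star_add_aux

noncomputable instance [IsScalarTower ℂ F F] [SMulCommClass ℂ F F] [StarModule ℂ F] :
    NonUnitalCStarAlgebra N.Envelope where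
  __ := (inferInstance : NonUnitalNormedRing N.Envelope)
  __ := (inferInstance : StarRing N.Envelope)
  __ := (inferInstance : CompleteSpace N.Envelope)
  __ := (inferInstance : NormedSpace ℂ N.Envelope)
  norm_mul_self_le := norm_star_mul_self_aux
  smul_assoc := smul_mul_aux
  smul_comm := mul_smul_aux
  star_smul := star_smul_aux

variable (N) in
/-- The canonical map of `F` into its completion, as a `*`-homomorphism. -/
noncomputable def ιHom : F →⋆ₙₐ[ℂ] N.Envelope where
  toFun := ι
  map_smul' := ι_smul
  map_zero' := ι_zero
  map_add' := ι_add
  map_mul' := ι_mul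
  map_star' := ι_star

theorem existsUnique_lift [IsScalarTower ℂ F F] [SMulCommClass ℂ F F] [StarModule ℂ F]
    {A : Type*} [NonUnitalCStarAlgebra A] (φ : F →⋆ₙₐ[ℂ] A) (hφ : ∀ a, ‖φ a‖ ≤ N a) :
    ∃! π : N.Envelope →⋆ₙₐ[ℂ] A, ∀ a, π (ι a) = φ a := by
  let φ' : N.Pre →+ A := { toFun := φ, map_zero' := map_zero φ, map_add' := map_add φ }
  have hcont : UniformContinuous φ' := by
    refine uniformContinuous_addMonoidHom_of_continuous
      (AddMonoidHomClass.continuous_of_bound φ' 1 fun a => ?_)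
    rw [one_mul]
    exact hφ a
  let g : N.Envelope → A := UniformSpace.Completion.extension φ'
  have hg : Continuous g := UniformSpace.Completion.continuous_extension
  have hgι : ∀ a, g (ι a) = φ a := fun a => UniformSpace.Completion.extension_coe hcont a
  refine ⟨{ toFun := g, map_smul' := ?_, map_zero' := ?_, map_add' := ?_, map_mul' := ?_,
            map_star' := ?_ }, hgι, ?_⟩
  · intro c a
    refine ind (P := fun a => g (c • a) = c • g a) a
      (isClosed_eq (hg.comp (continuous_const_smul c)) (hg.const_smul c)) fun a => ?_
    rw [← ι_smul, hgι, hgι, map_smul]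
  · change g 0 = 0
    rw [← ι_zero, hgι, map_zero]
  · intro a b
    change g (a + b) = g a + g b
    refine ind (P := fun a => g (a + b) = g a + g b) a
      (isClosed_eq (hg.comp (continuous_id.add continuous_const)) (hg.add continuous_const))
      fun a => ?_
    refine ind (P := fun b => g (ι a + b) = g (ι a) + g b) b
      (isClosed_eq (hg.comp (continuous_const.add continuous_id)) (continuous_const.add hg))
      fun b => ?_
    rw [← ι_add, hgι, hgι, hgι, map_add]
  · intro a b
    change g (a * b) = g a * g b
    refine ind (P := fun a => g (a * b) = g a * g b) a
      (isClosed_eq (hg.comp (continuous_id.mul continuous_const)) (hg.mul continuous_const))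
      fun a => ?_
    refine ind (P := fun b => g (ι a * b) = g (ι a) * g b) b
      (isClosed_eq (hg.comp (continuous_const.mul continuous_id)) (continuous_const.mul hg))
      fun b => ?_
    rw [← ι_mul, hgι, hgι, hgι, map_mul]
  · intro a

    refine ind (P := fun a => g (star a) = star (g a)) a
      (isClosed_eq (hg.comp continuous_star') (continuous_star.comp hg)) fun a => ?_
    rw [← ι_star, hgι, hgι, map_star]
  · intro π h
    have hπ : Continuous π :=
      AddMonoidHomClass.continuous_of_bound π 1 fun a => by
        rw [one_mul]; exact NonUnitalStarAlgHom.norm_apply_le π a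
    ext a
    change π a = g a
    refine ind (P := fun a => π a = g a) a (isClosed_eq hπ hg) fun a => ?_
    rw [h, hgι]

end Envelope
end Pre

end CStarSeminorm
end CStarSeminorm

/-! ### Higher-rank graphs -/

/-- A `k`-graph: a countable small category `Λ` with a degree functor to `ℕ^k` (coordinatewise
addition) satisfying the factorization property. A path `l` with source `a` and range `b` is a
morphism `l : a ⟶ b`, so the product `μν` of paths (first `ν`, then `μ`) is `ν ≫ μ`, and the vertices
are the objects. -/
class KGraph (k : outParam ℕ) (Λ : Type u) [Category.{v} Λ] extends CountableCategory Λ where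
  deg : ∀ {a b : Λ}, (a ⟶ b) → (Fin k → ℕ)
  deg_id : ∀ a : Λ, deg (𝟙 a) = 0
  deg_comp : ∀ {a b c : Λ} (ν : a ⟶ b) (μ : b ⟶ c), deg (ν ≫ μ) = deg μ + deg ν
  factorization : ∀ {a c : Λ} (l : a ⟶ c) (m n : Fin k → ℕ), deg l = m + n →
    ∃! p : (Σ b : Λ, (a ⟶ b) × (b ⟶ c)),
      deg p.2.2 = m ∧ deg p.2.1 = n ∧ p.2.1 ≫ p.2.2 = l

namespace KGraph

/-- The set `vΛ^n` of paths with range `v` and degree `n`. -/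
def pathsInto {k : ℕ} {Λ : Type u} [Category.{v} Λ] [KGraph k Λ] (w : Λ) (n : Fin k → ℕ) :
    Set (Σ a : Λ, a ⟶ w) :=
  {p | deg p.2 = n}

/-- `Λ` is row-finite: all the sets `vΛ^n` are finite. -/
class RowFinite {k : ℕ} (Λ : Type u) [Category.{v} Λ] [KGraph k Λ] : Prop where
  finite_pathsInto : ∀ (w : Λ) (n : Fin k → ℕ), (pathsInto w n).Finite

/-- `Λ` is strongly connected: `vΛw` is nonempty for all vertices `v`, `w`. -/
def StronglyConnected (Λ : Type u) [Category.{v} Λ] : Prop :=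
  ∀ b a : Λ, Nonempty (a ⟶ b)

/-- The objects of the `k`-graph `Ω_k`, i.e. the points of `ℕ^k`. -/
structure Omega (k : ℕ) where
  pt : Fin k → ℕ

/-- `Ω_k` has exactly one morphism, with source `q` and range `p`, for each pair `p ≤ q`. -/
instance (k : ℕ) : Category.{0} (Omega k) where
  Hom q p := PLift (p.pt ≤ q.pt)
  id _ := ⟨le_rfl⟩
  comp f g := ⟨g.down.trans f.down⟩

/-- The degree of the morphism `(p, q)` of `Ω_k` is `q - p`. -/
instance (k : ℕ) : KGraph k (Omega k) where
  countableObj :=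
    Function.Injective.countable (f := Omega.pt) (by rintro ⟨_⟩ ⟨_⟩ h; exact congrArg _ h)
  countableHom _ _ := inferInstanceAs (Countable (PLift _))
  deg {q p} _ := q.pt - p.pt
  deg_id q := funext fun _ => Nat.sub_self _
  deg_comp {a b c} f g := funext fun i => by
    have h1 : b.pt i ≤ a.pt i := f.down i
    have h2 : c.pt i ≤ b.pt i := g.down i
    simp only [Pi.sub_apply, Pi.add_apply]
    omega
  factorization {a c} l m n h := by
    have hl : c.pt ≤ a.pt := l.down
    refine ⟨⟨⟨c.pt + m⟩, ⟨fun i => ?_⟩, ⟨fun i => ?_⟩⟩, ⟨?_, ?_, rfl⟩, ?_⟩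
    · have h2 : c.pt i ≤ a.pt i := hl i
      have h1 : a.pt i - c.pt i = m i + n i := congrFun h i
      change c.pt i + m i ≤ a.pt i
      omega
    · simp
    · funext i
      change c.pt i + m i - c.pt i = m i
      omega
    · funext i
      have h2 : c.pt i ≤ a.pt i := hl i
      have h1 : a.pt i - c.pt i = m i + n i := congrFun h i
      change a.pt i - (c.pt i + m i) = n i
      omega
    · rintro ⟨⟨b⟩, ⟨f⟩, ⟨g⟩⟩ ⟨h1, -, -⟩
      have : b = c.pt + m := by
        funext i
        have h3 : b i - c.pt i = m i := congrFun h1 i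
        have h4 : c.pt i ≤ b i := g i
        change b i = c.pt i + m i
        omega
      subst this
      rfl

/-- An infinite path: a degree-preserving functor `x : Ω_k → Λ`. -/
structure InfinitePath {k : ℕ} (Λ : Type u) [Category.{v} Λ] [KGraph k Λ] where
  toFunctor : Omega k ⥤ Λ
  deg_map : ∀ {q p : Omega k} (f : q ⟶ p), deg (toFunctor.map f) = deg f

/-! ### Cuntz-Krieger families and `C*(Λ)` -/

section CK

variable {k : ℕ} {Λ : Type u} [Category.{v} Λ] [KGraph k Λ] [RowFinite Λ]

/-- The Cuntz-Krieger relations for a family `t` indexed by the paths of `Λ`: `CKRel t x y` says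
that `x = y` is one of the relations. -/
inductive CKRel {A : Type*} [NonUnitalRing A] [StarRing A] (t : ∀ ⦃a b : Λ⦄, (a ⟶ b) → A) :
    A → A → Prop
  | partial_isometry {a b : Λ} (l : a ⟶ b) : CKRel t (t l * star (t l) * t l) (t l)
  | vertex_star (w : Λ) : CKRel t (star (t (𝟙 w))) (t (𝟙 w))
  | vertex_idem (w : Λ) : CKRel t (t (𝟙 w) * t (𝟙 w)) (t (𝟙 w))
  | vertex_orth {w w' : Λ} (h : w ≠ w') : CKRel t (t (𝟙 w) * t (𝟙 w')) 0
  | mul {a b c : Λ} (ν : a ⟶ b) (μ : b ⟶ c) : CKRel t (t μ * t ν) (t (ν ≫ μ))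
  | star_mul {a b : Λ} (l : a ⟶ b) : CKRel t (star (t l) * t l) (t (𝟙 a))
  | sum (w : Λ) (n : Fin k → ℕ) : CKRel t (t (𝟙 w))
      (∑ p ∈ (RowFinite.finite_pathsInto w n).toFinset, t p.2 * star (t p.2))

/-- `t` is a Cuntz-Krieger `Λ`-family. -/
def IsCuntzKriegerFamily {A : Type*} [NonUnitalRing A] [StarRing A]
    (t : ∀ ⦃a b : Λ⦄, (a ⟶ b) → A) : Prop :=
  ∀ x y : A, CKRel t x y → x = y

variable (Λ)

/-- The set of all paths of `Λ`. -/
abbrev Path : Type (max u v) := Σ a b : Λ, (a ⟶ b)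

variable {Λ} in
/-- The generator of the free `*`-algebra attached to a path. -/
noncomputable def freeGen ⦃a b : Λ⦄ (l : a ⟶ b) : FreeStarAlg (Path Λ) :=
  FreeStarAlg.gen ⟨a, b, l⟩

/-- The `C*`-seminorms on the free `*`-algebra on the paths of `Λ` for which the Cuntz-Krieger
relations hold in the quotient by the null space. -/
def ckSeminorms : Set (CStarSeminorm (FreeStarAlg (Path Λ))) :=
  {N | ∀ x y, CKRel (freeGen (Λ := Λ)) x y → N (x - y) = 0}

theorem ckSeminorms_nonempty : (ckSeminorms Λ).Nonempty :=
  ⟨CStarSeminorm.zero, fun _ _ _ => rfl⟩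

theorem seminorm_eq_of_sub {F : Type*} [NonUnitalRing F] [StarRing F] [Module ℂ F]
    (N : CStarSeminorm F) {x y : F} (h : N (x - y) = 0) : N x = N y := by
  have h1 := map_add_le_add N (x - y) y
  have h2 := map_add_le_add N (-(x - y)) x
  rw [map_neg_eq_map] at h2
  simp only [sub_add_cancel, neg_sub, h, zero_add] at h1 h2
  exact le_antisymm h1 h2

variable {Λ}

theorem ck_gen_le_one {N : CStarSeminorm (FreeStarAlg (Path Λ))} (hN : N ∈ ckSeminorms Λ)
    {a b : Λ} (l : a ⟶ b) : N (freeGen l) ≤ 1 := by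
  have key : ∀ c : Λ, N (freeGen (𝟙 c)) ^ 2 = N (freeGen (𝟙 c)) := fun c => by
    rw [← N.star_mul_self]
    exact seminorm_eq_of_sub N (hN _ _ (CKRel.star_mul (t := freeGen) (𝟙 c)))
  have h2 : N (freeGen l) ^ 2 = N (freeGen (𝟙 a)) := by
    rw [← N.star_mul_self]
    exact seminorm_eq_of_sub N (hN _ _ (CKRel.star_mul (t := freeGen) l))
  have h3 : N (freeGen (𝟙 a)) ≤ 1 := by nlinarith [key a, apply_nonneg N (freeGen (𝟙 a))]
  nlinarith [apply_nonneg N (freeGen l)]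

theorem ck_word_le_one {N : CStarSeminorm (FreeStarAlg (Path Λ))} (hN : N ∈ ckSeminorms Λ)
    (w : FreeSemigroup (Path Λ × Bool)) : N (FreeStarAlg.mono w 1) ≤ 1 := by
  have h1 : ∀ p : Path Λ × Bool, N (FreeStarAlg.mono (FreeSemigroup.of p) 1) ≤ 1 := by
    rintro ⟨⟨a, b, l⟩, _ | _⟩
    · exact ck_gen_le_one hN l
    · rw [← FreeStarAlg.star_gen, N.star_eq]; exact ck_gen_le_one hN l
  induction w with
  | ih1 p => exact h1 p
  | ih2 p w _ h =>
    have : FreeStarAlg.mono (FreeSemigroup.of p * w) 1 =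
        FreeStarAlg.mono (FreeSemigroup.of p) 1 * FreeStarAlg.mono w 1 := by
      rw [FreeStarAlg.mono_mul, one_mul]
    rw [this]
    exact (N.mul_le _ _).trans (mul_le_one₀ (h1 p) (apply_nonneg _ _) h)

variable (Λ)

theorem ckSeminorms_bdd (x : FreeStarAlg (Path Λ)) :
    BddAbove (Set.range fun N : ckSeminorms Λ => N.1 x) := by
  induction x using FreeStarAlg.ind with
  | hm w c =>
    refine ⟨‖c‖, ?_⟩
    rintro _ ⟨N, rfl⟩
    have : FreeStarAlg.mono w c = c • FreeStarAlg.mono w 1 := by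
      rw [FreeStarAlg.smul_mono, mul_one]
    simp only [this, map_smul_eq_mul]
    exact mul_le_of_le_one_right (norm_nonneg c) (ck_word_le_one N.2 w)
  | h0 => exact ⟨0, by rintro _ ⟨N, rfl⟩; simp⟩
  | ha x y hx hy =>
    obtain ⟨M, hM⟩ := hx
    obtain ⟨M', hM'⟩ := hy
    refine ⟨M + M', ?_⟩
    rintro _ ⟨N, rfl⟩
    exact (map_add_le_add N.1 x y).trans (add_le_add (hM ⟨N, rfl⟩) (hM' ⟨N, rfl⟩))

/-- The largest `C*`-seminorm on the free `*`-algebra on the paths of `Λ` that is compatible with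
the Cuntz-Krieger relations. -/
noncomputable def ckSeminorm : CStarSeminorm (FreeStarAlg (Path Λ)) :=
  CStarSeminorm.sup (ckSeminorms Λ) (ckSeminorms_nonempty Λ) (ckSeminorms_bdd Λ)

/-- `C*(Λ)`, the universal `C*`-algebra generated by a Cuntz-Krieger `Λ`-family. -/
abbrev CStar : Type (max u v) := (ckSeminorm Λ).Envelope

variable {Λ}

/-- The universal Cuntz-Krieger family in `C*(Λ)`. -/
noncomputable def univ ⦃a b : Λ⦄ (l : a ⟶ b) : CStar Λ :=
  CStarSeminorm.Envelope.ι (N := ckSeminorm Λ) (freeGen l)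

/-- The elements `univ l` form a Cuntz-Krieger family in `C*(Λ)`. -/
theorem isCuntzKriegerFamily_univ : IsCuntzKriegerFamily (univ (Λ := Λ)) := by
  intro x y h
  obtain ⟨a, b, hab, rfl, rfl⟩ : ∃ a b, CKRel (freeGen (Λ := Λ)) a b ∧
      CStarSeminorm.Envelope.ι (N := ckSeminorm Λ) a = x ∧
      CStarSeminorm.Envelope.ι (N := ckSeminorm Λ) b = y := by
    cases h with
    | partial_isometry l => exact ⟨_, _, .partial_isometry l, by
        simp only [CStarSeminorm.Envelope.ι_mul, CStarSeminorm.Envelope.ι_star]; rfl, rfl⟩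
    | vertex_star w => exact ⟨_, _, .vertex_star w, CStarSeminorm.Envelope.ι_star _, rfl⟩
    | vertex_idem w => exact ⟨_, _, .vertex_idem w, CStarSeminorm.Envelope.ι_mul _ _, rfl⟩
    | vertex_orth h => exact ⟨_, _, .vertex_orth h, CStarSeminorm.Envelope.ι_mul _ _,
        CStarSeminorm.Envelope.ι_zero⟩
    | mul ν μ => exact ⟨_, _, .mul ν μ, CStarSeminorm.Envelope.ι_mul _ _, rfl⟩
    | star_mul l => exact ⟨_, _, .star_mul l, by
        simp only [CStarSeminorm.Envelope.ι_mul, CStarSeminorm.Envelope.ι_star]; rfl, rfl⟩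
    | sum w n => exact ⟨_, _, .sum w n, rfl, by
        rw [show CStarSeminorm.Envelope.ι (N := ckSeminorm Λ) _ = _ from
          map_sum (CStarSeminorm.Envelope.ιHom (ckSeminorm Λ)) _ _]
        change ∑ p ∈ _, CStarSeminorm.Envelope.ι (N := ckSeminorm Λ) _ = _
        simp only [CStarSeminorm.Envelope.ι_mul, CStarSeminorm.Envelope.ι_star]; rfl⟩
  have h0 : ckSeminorm Λ (a - b) = 0 := by
    have : Nonempty (ckSeminorms Λ) := (ckSeminorms_nonempty Λ).to_subtype
    change (⨆ N : ckSeminorms Λ, N.1 (a - b)) = 0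
    simp only [fun N : ckSeminorms Λ => N.2 _ _ hab, ciSup_const]
  rw [← sub_eq_zero, ← norm_eq_zero]
  refine Eq.trans ?_ h0
  rw [← CStarSeminorm.Envelope.norm_ι]
  exact congrArg norm (map_sub (CStarSeminorm.Envelope.ιHom (ckSeminorm Λ)) a b).symm

/-- The universal property of `C*(Λ)`: every Cuntz-Krieger family in a `C*`-algebra is the image of
the family `univ` under a unique `*`-homomorphism. -/
theorem existsUnique_lift {A : Type*} [NonUnitalCStarAlgebra A] (s : ∀ ⦃a b : Λ⦄, (a ⟶ b) → A)
    (hs : IsCuntzKriegerFamily s) :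
    ∃! π : CStar Λ →⋆ₙₐ[ℂ] A, ∀ ⦃a b : Λ⦄ (l : a ⟶ b), π (univ l) = s l := by
  obtain ⟨φ, hφ⟩ := FreeStarAlg.exists_lift (fun p : Path Λ => s p.2.2)
  have hφ' : ∀ ⦃a b : Λ⦄ (l : a ⟶ b), φ (freeGen l) = s l := fun a b l => hφ ⟨a, b, l⟩
  have hrel : ∀ x y, CKRel (freeGen (Λ := Λ)) x y → φ x = φ y := by
    intro x y h
    apply hs
    cases h with
    | partial_isometry l => simp only [map_mul, map_star, hφ']; exact .partial_isometry l
    | vertex_star w => simp only [map_star, hφ']; exact .vertex_star w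
    | vertex_idem w => simp only [map_mul, hφ']; exact .vertex_idem w
    | vertex_orth h => simp only [map_mul, map_zero, hφ']; exact .vertex_orth h
    | mul ν μ => simp only [map_mul, hφ']; exact .mul ν μ
    | star_mul l => simp only [map_mul, map_star, hφ']; exact .star_mul l
    | sum w n => simp only [map_sum, map_mul, map_star, hφ']; exact .sum w n
  have hmem : CStarSeminorm.comap φ ∈ ckSeminorms Λ := fun x y h => by
    change ‖φ (x - y)‖ = 0
    rw [map_sub, hrel x y h, sub_self, norm_zero]
  obtain ⟨π, hπ, huniq⟩ := CStarSeminorm.Envelope.existsUnique_lift (N := ckSeminorm Λ) φ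
    (fun a => CStarSeminorm.le_sup (ckSeminorms_nonempty Λ) (ckSeminorms_bdd Λ) hmem a)
  refine ⟨π, fun a b l => (hπ _).trans (hφ' l), fun π' h' => huniq π' fun a => ?_⟩
  have : (π'.comp (CStarSeminorm.Envelope.ιHom (ckSeminorm Λ))) = φ :=
    FreeStarAlg.hom_ext fun p => (h' p.2.2).trans (hφ p).symm
  exact DFunLike.congr_fun this a

end CK
end KGraph

/-! ### Inductive limits of Hilbert spaces -/

section HilbertLimit

variable {I : Type*} [Preorder I] [IsDirectedOrder I] {E : I → Type*}
  [∀ i, NormedAddCommGroup (E i)] [∀ i, InnerProductSpace ℂ (E i)]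
  (f : ∀ i j, i ≤ j → E i →ₗᵢ[ℂ] E j) [DirectedSystem E (f · · ·)]

/-- The algebraic direct limit (disjoint union modulo eventual equality) of a directed system of
inner product spaces and linear isometries. -/
def AlgLimit : Type _ := DirectLimit E f

namespace AlgLimit

/-- The class in the direct limit of an element of the `i`-th space. -/
def mk (i : I) (a : E i) : AlgLimit f := (⟦⟨i, a⟩⟧ : DirectLimit E f)

theorem mk_map {i j : I} (h : i ≤ j) (a : E i) : mk f j (f i j h a) = mk f i a :=
  (DirectLimit.eq_of_le (f := f) ⟨i, a⟩ j h).symm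

/-- The inner product of the classes of `a, b ∈ E i` is their inner product in `E i`. -/
noncomputable instance : Inner ℂ (AlgLimit f) where
  inner := DirectLimit.lift₂ f f (fun _ a b => inner ℂ a b)
    (fun i j h a b => ((f i j h).inner_map_map a b).symm)

theorem inner_mk (i : I) (a b : E i) : inner ℂ (mk f i a) (mk f i b) = inner ℂ a b :=
  DirectLimit.lift₂_def f f _ _ i a b

theorem ind {P : AlgLimit f → Prop} (h : ∀ i a, P (mk f i a)) (x : AlgLimit f) : P x :=
  DirectLimit.induction f h x

theorem ind₂ {P : AlgLimit f → AlgLimit f → Prop} (h : ∀ i a b, P (mk f i a) (mk f i b))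
    (x y : AlgLimit f) : P x y :=
  DirectLimit.induction₂ f h x y

theorem ind₃ {P : AlgLimit f → AlgLimit f → AlgLimit f → Prop}
    (h : ∀ i a b c, P (mk f i a) (mk f i b) (mk f i c)) (x y z : AlgLimit f) : P x y z :=
  DirectLimit.induction₃ f h x y z

theorem conj_inner (x y : AlgLimit f) : conj (inner ℂ y x) = inner ℂ x y :=
  ind₂ f (P := fun x y => conj (inner ℂ y x) = inner ℂ x y)
    (fun i a b => by simp only [inner_mk, inner_conj_symm]) x y

theorem inner_nonneg (x : AlgLimit f) : 0 ≤ RCLike.re (inner ℂ x x) :=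
  ind f (P := fun x => 0 ≤ RCLike.re (inner ℂ x x))
    (fun i a => by rw [inner_mk]; exact inner_self_nonneg) x

variable [Nonempty I]

noncomputable instance : AddCommGroup (AlgLimit f) := inferInstanceAs (AddCommGroup (DirectLimit E f))
noncomputable instance : Module ℂ (AlgLimit f) := inferInstanceAs (Module ℂ (DirectLimit E f))

theorem mk_add (i : I) (a b : E i) : mk f i (a + b) = mk f i a + mk f i b :=
  (DirectLimit.add_def i a b).symm

theorem mk_smul (i : I) (c : ℂ) (a : E i) : mk f i (c • a) = c • mk f i a :=
  (DirectLimit.smul_def i a c).symm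

theorem mk_zero (i : I) : mk f i 0 = 0 := (DirectLimit.zero_def i).symm

theorem inner_add (x y z : AlgLimit f) : inner ℂ (x + y) z = inner ℂ x z + inner ℂ y z :=
  ind₃ f (P := fun x y z => inner ℂ (x + y) z = inner ℂ x z + inner ℂ y z)
    (fun i a b c => by simp only [← mk_add, inner_mk, inner_add_left]) x y z

theorem inner_smul (x y : AlgLimit f) (c : ℂ) : inner ℂ (c • x) y = conj c * inner ℂ x y :=
  ind₂ f (P := fun x y => inner ℂ (c • x) y = conj c * inner ℂ x y)
    (fun i a b => by simp only [← mk_smul, inner_mk, inner_smul_left]) x y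

theorem inner_definite (x : AlgLimit f) : inner ℂ x x = 0 → x = 0 :=
  ind f (P := fun x => inner ℂ x x = 0 → x = 0)
    (fun i a h => by rw [inner_mk, inner_self_eq_zero] at h; rw [h, mk_zero]) x

noncomputable instance core : InnerProductSpace.Core ℂ (AlgLimit f) where
  __ := (inferInstance : Inner ℂ (AlgLimit f))
  conj_inner_symm := conj_inner f
  re_inner_nonneg := inner_nonneg f
  add_left := inner_add f
  smul_left := inner_smul f
  definite := inner_definite f

noncomputable instance : NormedAddCommGroup (AlgLimit f) :=
  (core f).toNormedAddCommGroup

noncomputable instance : InnerProductSpace ℂ (AlgLimit f) :=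
  InnerProductSpace.ofCore (core f).toCore

end AlgLimit

/-- The inductive limit Hilbert space of a directed system of inner product spaces and linear
isometries: the completion of the algebraic direct limit. -/
abbrev HilbertLimit [Nonempty I] : Type _ := UniformSpace.Completion (AlgLimit f)

/-- The class in the inductive limit Hilbert space of an element of the `i`-th space. -/
noncomputable def HilbertLimit.mk [Nonempty I] (i : I) (a : E i) : HilbertLimit f :=
  UniformSpace.Completion.coe' (AlgLimit.mk f i a)

end HilbertLimit

/-! ### The Hilbert space of an infinite path -/

namespace KGraph
namespace InfinitePath

variable {k : ℕ} {Λ : Type u} [Category.{v} Λ] [KGraph k Λ] (x : InfinitePath Λ)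

/-- The point `(i, …, i)` of `ℕ^k`. -/
def diag (k i : ℕ) : Omega k := ⟨fun _ => i⟩

/-- The vertex `v_i = x(i, …, i)`. -/
def vertex (i : ℕ) : Λ := x.toFunctor.obj (diag k i)

/-- The path `x((i, …, i), (j, …, j))`, with range `v_i` and source `v_j`. Writing
`x = x_0 x_1 x_2 ⋯` with `d(x_i) = (1, …, 1)`, this is `x_i x_{i+1} ⋯ x_{j-1}`. -/
def segment {i j : ℕ} (h : i ≤ j) : x.vertex j ⟶ x.vertex i :=
  x.toFunctor.map (X := diag k j) (Y := diag k i) ⟨fun _ => h⟩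

theorem segment_comp {i j l : ℕ} (hij : i ≤ j) (hjl : j ≤ l) :
    x.segment hjl ≫ x.segment hij = x.segment (hij.trans hjl) :=
  (x.toFunctor.map_comp _ _).symm

theorem segment_self (i : ℕ) : x.segment (le_refl i) = 𝟙 _ := x.toFunctor.map_id _

/-- The set `F_i = Λ v_i` of paths with source `v_i`. -/
abbrev F (i : ℕ) : Type (max u v) := Σ w : Λ, (x.vertex i ⟶ w)

/-- The Hilbert space `ℓ²(F_i)`. -/
abbrev L2 (i : ℕ) : Type (max u v) := lp (fun _ : x.F i => ℂ) 2

open Classical in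
/-- The standard basis vector `ξ^i_μ` of `ℓ²(F_i)`. -/
noncomputable def basisVec (i : ℕ) (μ : x.F i) : x.L2 i := lp.single 2 μ 1

/-- The map `F_i → F_j`, `μ ↦ μ x_i ⋯ x_{j-1}`. -/
def append {i j : ℕ} (h : i ≤ j) (μ : x.F i) : x.F j := ⟨μ.1, x.segment h ≫ μ.2⟩

theorem append_injective {i j : ℕ} (h : i ≤ j) : Function.Injective (x.append h) := by
  rintro ⟨w, μ⟩ ⟨w', μ'⟩ heq
  obtain rfl : w = w' := congrArg Sigma.fst heq
  have h1 : x.segment h ≫ μ = x.segment h ≫ μ' := by simpa [append] using heq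
  obtain ⟨p, -, hp⟩ := KGraph.factorization (x.segment h ≫ μ) (KGraph.deg μ)
    (KGraph.deg (x.segment h)) (KGraph.deg_comp _ _)
  have hd : KGraph.deg μ' = KGraph.deg μ := by
    have := congrArg KGraph.deg h1
    rw [KGraph.deg_comp, KGraph.deg_comp] at this
    exact (add_right_cancel this).symm
  have e1 := hp ⟨_, x.segment h, μ⟩ ⟨rfl, rfl, rfl⟩
  have e2 := hp ⟨_, x.segment h, μ'⟩ ⟨hd, rfl, h1.symm⟩
  have e3 := e1.trans e2.symm
  simpa using e3

theorem orthonormal_append {i j : ℕ} (h : i ≤ j) :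
    Orthonormal ℂ fun μ : x.F i => x.basisVec j (x.append h μ) := by
  classical
  rw [orthonormal_iff_ite]
  intro μ μ'
  rw [basisVec, lp.inner_single_left]
  simp [basisVec, lp.single_apply, Pi.single_apply, (x.append_injective h).eq_iff]

/-- The linear isometry `ρ_{j-1} ⋯ ρ_i : ℓ²(F_i) → ℓ²(F_j)`, which takes the basis vector `ξ^i_μ` to
`ξ^j_{μ x_i ⋯ x_{j-1}}`; in particular, it is `ρ_i` for `j = i + 1`. -/
noncomputable def trans (i j : ℕ) (h : i ≤ j) : x.L2 i →ₗᵢ[ℂ] x.L2 j :=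
  (x.orthonormal_append h).orthogonalFamily.linearIsometry

theorem trans_basisVec {i j : ℕ} (h : i ≤ j) (μ : x.F i) :
    x.trans i j h (x.basisVec i μ) = x.basisVec j (x.append h μ) := by
  classical
  rw [trans, basisVec, OrthogonalFamily.linearIsometry_apply_single]
  simp

theorem ext_basisVec {i : ℕ} {E : Type*} [NormedAddCommGroup E] [NormedSpace ℂ E]
    {S T : x.L2 i →L[ℂ] E} (h : ∀ μ, S (x.basisVec i μ) = T (x.basisVec i μ)) : S = T := by
  classical
  ext a
  have hs := lp.hasSum_single (p := 2) (by simp) a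
  have key : ∀ μ, (lp.single 2 μ (a μ) : x.L2 i) = a μ • x.basisVec i μ := fun μ => by
    rw [basisVec, ← lp.single_smul, smul_eq_mul, mul_one]
  have h1 := S.hasSum hs
  have h2 := T.hasSum hs
  simp only [key, map_smul, h] at h1 h2
  exact h1.unique h2

instance : DirectedSystem x.L2 (x.trans · · ·) where
  map_self i a := by
    have : (x.trans i i le_rfl).toContinuousLinearMap = ContinuousLinearMap.id ℂ _ :=
      x.ext_basisVec fun μ => by
        simp [trans_basisVec, append, segment_self]
    exact congrArg (fun S : x.L2 i →L[ℂ] x.L2 i => S a) this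
  map_map l j i hij hjl a := by
    have : (x.trans j l hjl).toContinuousLinearMap.comp (x.trans i j hij).toContinuousLinearMap =
        (x.trans i l (hij.trans hjl)).toContinuousLinearMap :=
      x.ext_basisVec fun μ => by
        simp [trans_basisVec, append, ← Category.assoc, segment_comp]
    exact congrArg (fun S : x.L2 i →L[ℂ] x.L2 l => S a) this

/-- The inductive limit Hilbert space `H_x` of the spaces `ℓ²(F_i)`. -/
abbrev H : Type (max u v) := HilbertLimit x.trans

/-- The class `[ξ^i_μ]` in `H_x` of the basis vector `ξ^i_μ` of `ℓ²(F_i)`. -/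
noncomputable def ξ (i : ℕ) {w : Λ} (μ : x.vertex i ⟶ w) : x.H :=
  HilbertLimit.mk x.trans i (x.basisVec i ⟨w, μ⟩)

/-- `T` consists of the prefixing operators on `H_x`: `T_λ [ξ^i_μ] = [ξ^i_{λμ}]` if `s(λ) = r(μ)`,
and `T_λ [ξ^i_μ] = 0` otherwise. -/
def IsPrefixing (T : ∀ ⦃a b : Λ⦄, (a ⟶ b) → (x.H →L[ℂ] x.H)) : Prop :=
  (∀ ⦃a b : Λ⦄ (l : a ⟶ b) (i : ℕ) (μ : x.vertex i ⟶ a), T l (x.ξ i μ) = x.ξ i (μ ≫ l)) ∧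
  ∀ ⦃a b : Λ⦄ (l : a ⟶ b) (i : ℕ) (w : Λ) (μ : x.vertex i ⟶ w), w ≠ a → T l (x.ξ i μ) = 0

end InfinitePath
end KGraph

/-! ### Relations in Cuntz-Krieger families -/

/-! The argument is that of the gauge-invariant uniqueness theorem, with a grading of
$\mathcal{H}_x$ in place of a gauge action on the image of $\pi_x$.

The vector $[\xi^i_\mu]$ has a well-defined degree $d(\mu)-(i,\dots,i)\in\mathbb{Z}^k$: passing from
$\mu$ to $\mu x_i$ adds $(1,\dots,1)$ to both terms (`degξ_segment`). Vectors of different degrees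
are orthogonal and $T_\lambda$ shifts degrees by $d(\lambda)$. Hence the spectral component $y_n$ of
$y\in C^*(\Lambda)$ under the gauge action of the torus acts on $\mathcal{H}_x$ as the part of
$\pi_x(y)$ that raises degrees by $n$ (`inner_spectralPart`). So $\pi_x(y)=0$ forces $\pi_x(y_n)=0$
for all $n$. Periodicity of $x$ does no harm, since the degree remembers how far along $x$ a vector
sits.

It remains to see that $y_n=0$ (`injective_of_spectralPart`). The element $y_n^*y_n$ lies in the
core, the closure of the increasing union of the spans of $t_\alpha t_\beta^*$ with
$d(\alpha)=d(\beta)=m$. On each level these products behave like matrix units, so compression by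
paths of degree $m$ reduces an element to multiples of vertex projections
(`eq_zero_of_mem_closure_level`). A $*$-homomorphism that kills no vertex projection is therefore
isometric on the core (`norm_map_of_mem_closure_gradedSpan`). No $T_w$ vanishes, because strong
connectedness supplies a path from $v_0$ to $w$. Finally, an element all of whose spectral
components vanish is zero, because a continuous function on the torus is determined by its Fourier
coefficients.

The operators $T_\lambda$ exist because two vectors $[\xi^i_\mu]$, $[\xi^j_\nu]$ are either equal or
orthogonal, and prefixing respects this alternative (`exists_orthonormal_prefix`). The summation
relation holds because any $\mu$ can be lengthened along $x$ until it has an initial segment of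
prescribed degree (`exists_ξ_eq_comp`). -/

/-- A `*`-homomorphism between `C*`-algebras is continuous. -/
theorem continuous_nonUnitalStarAlgHom {A B : Type*} [NonUnitalCStarAlgebra A]
    [NonUnitalCStarAlgebra B] (φ : A →⋆ₙₐ[ℂ] B) : Continuous φ :=
  AddMonoidHomClass.continuous_of_bound φ 1 fun a => by
    rw [one_mul]; exact NonUnitalStarAlgHom.norm_apply_le φ a

/-- Projections in a `C*`-algebra which are dominated by their (finite) sum are mutually
orthogonal. -/
theorem mul_eq_zero_of_mul_sum_eq_self {A : Type*} [NonUnitalCStarAlgebra A] {ι : Type*}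
    {s : Finset ι} {p : ι → A} (hp : ∀ i ∈ s, IsStarProjection (p i))
    (hs : ∀ i ∈ s, p i * ∑ j ∈ s, p j = p i) {i j : ι} (hi : i ∈ s) (hj : j ∈ s) (hij : i ≠ j) :
    p j * p i = 0 := by
  classical
  -- The spectral order is needed because the argument is one of positivity: compressing the
  -- remaining projections by `p i` gives positive elements with sum zero, so each of them vanishes.
  let _ := CStarAlgebra.spectralOrder A
  have _ := CStarAlgebra.spectralOrderedRing A
  have hterm : ∀ n ∈ s, p i * p n * p i = star (p n * p i) * (p n * p i) := fun n hn => by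
    rw [star_mul, (hp i hi).isSelfAdjoint.star_eq, (hp n hn).isSelfAdjoint.star_eq, mul_assoc,
      mul_assoc, ← mul_assoc (p n) (p n), (hp n hn).isIdempotentElem.eq]
  have hsum : ∑ n ∈ s.erase i, p i * p n * p i = 0 := by
    have h := hs i hi
    rw [← Finset.add_sum_erase s p hi, mul_add, (hp i hi).isIdempotentElem.eq, add_eq_left] at h
    rw [← Finset.sum_mul, ← Finset.mul_sum, h, zero_mul]
  have h0 := (Finset.sum_eq_zero_iff_of_nonneg fun n hn => by
    rw [hterm n (Finset.mem_of_mem_erase hn)]; exact star_mul_self_nonneg _).1 hsum j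
      (Finset.mem_erase.2 ⟨hij.symm, hj⟩)
  rwa [hterm j hj, CStarRing.star_mul_self_eq_zero_iff] at h0

namespace KGraph
namespace IsCuntzKriegerFamily

section

variable {k : ℕ} {Λ : Type u} [Category.{v} Λ] [KGraph k Λ] [RowFinite Λ]
  {A : Type*} [NonUnitalCStarAlgebra A] {t : ∀ ⦃a b : Λ⦄, (a ⟶ b) → A}

theorem mul_star_mul (ht : IsCuntzKriegerFamily t) {a b : Λ} (l : a ⟶ b) :
    t l * star (t l) * t l = t l := ht _ _ (.partial_isometry l)

theorem star_id (ht : IsCuntzKriegerFamily t) (w : Λ) : star (t (𝟙 w)) = t (𝟙 w) :=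
  ht _ _ (.vertex_star w)

theorem mul_of_comp (ht : IsCuntzKriegerFamily t) {a b c : Λ} (n : a ⟶ b) (m : b ⟶ c) :
    t m * t n = t (n ≫ m) := ht _ _ (.mul n m)

theorem star_mul_self (ht : IsCuntzKriegerFamily t) {a b : Λ} (l : a ⟶ b) :
    star (t l) * t l = t (𝟙 a) := ht _ _ (.star_mul l)

theorem id_eq_sum (ht : IsCuntzKriegerFamily t) (w : Λ) (n : Fin k → ℕ) : t (𝟙 w) =
    ∑ p ∈ (RowFinite.finite_pathsInto w n).toFinset, t p.2 * star (t p.2) := ht _ _ (.sum w n)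

theorem mul_id (ht : IsCuntzKriegerFamily t) {a b : Λ} (l : a ⟶ b) : t l * t (𝟙 a) = t l := by
  rw [ht.mul_of_comp, Category.id_comp]

theorem id_mul (ht : IsCuntzKriegerFamily t) {a b : Λ} (l : a ⟶ b) : t (𝟙 b) * t l = t l := by
  rw [ht.mul_of_comp, Category.comp_id]

theorem id_mul_star (ht : IsCuntzKriegerFamily t) {a b : Λ} (l : a ⟶ b) :
    t (𝟙 a) * star (t l) = star (t l) := by
  rw [← ht.star_id, ← star_mul, ht.mul_id]

theorem star_mul_id (ht : IsCuntzKriegerFamily t) {a b : Λ} (l : a ⟶ b) :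
    star (t l) * t (𝟙 b) = star (t l) := by
  rw [← ht.star_id, ← star_mul, ht.id_mul]

theorem id_mul_id_of_ne (ht : IsCuntzKriegerFamily t) {w w' : Λ} (h : w ≠ w') :
    t (𝟙 w) * t (𝟙 w') = 0 := ht _ _ (.vertex_orth h)

theorem mul_eq_zero_of_source_ne (ht : IsCuntzKriegerFamily t) {a b c d : Λ} (m : a ⟶ b)
    (l : c ⟶ d) (h : a ≠ d) : t m * t l = 0 := by
  rw [← ht.mul_id m, ← ht.id_mul l, mul_assoc, ← mul_assoc (t (𝟙 a)), ht.id_mul_id_of_ne h,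
    zero_mul, mul_zero]

theorem star_mul_eq_zero_of_range_ne (ht : IsCuntzKriegerFamily t) {a b c d : Λ} (m : a ⟶ b)
    (l : c ⟶ d) (h : b ≠ d) : star (t m) * t l = 0 := by
  rw [← ht.star_mul_id m, ← ht.id_mul l, mul_assoc, ← mul_assoc (t (𝟙 b)), ht.id_mul_id_of_ne h,
    zero_mul, mul_zero]

theorem isStarProjection_range (ht : IsCuntzKriegerFamily t) {a b : Λ} (l : a ⟶ b) :
    IsStarProjection (t l * star (t l)) where
  isIdempotentElem := by
    rw [IsIdempotentElem, ← mul_assoc, ht.mul_star_mul]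
  isSelfAdjoint := IsSelfAdjoint.mul_star_self _

/-- Distinct paths of the same degree have orthogonal ranges. -/
theorem star_mul_eq_zero_of_ne (ht : IsCuntzKriegerFamily t) {a a' b : Λ} (l : a ⟶ b)
    (l' : a' ⟶ b) (hd : deg l = deg l') (h : (⟨a, l⟩ : Σ a, a ⟶ b) ≠ ⟨a', l'⟩) :
    star (t l) * t l' = 0 := by
  have hmem : ∀ p : Σ a, a ⟶ b, p ∈ (RowFinite.finite_pathsInto b (deg l)).toFinset ↔
      deg p.2 = deg l := fun p => by simp [pathsInto]
  have h0 := mul_eq_zero_of_mul_sum_eq_self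
    (s := (RowFinite.finite_pathsInto b (deg l)).toFinset)
    (p := fun p : Σ a, a ⟶ b => t p.2 * star (t p.2)) (fun i _ => ht.isStarProjection_range i.2)
    (fun i _ => by rw [← ht.id_eq_sum, mul_assoc, ht.star_mul_id])
    (i := ⟨a', l'⟩) (j := ⟨a, l⟩) ((hmem _).2 hd.symm) ((hmem _).2 rfl) h.symm
  -- Both range projections are inserted, so that their vanishing product appears in the middle.
  have h1 : star (t l) * t l' = star (t l) * ((t l * star (t l)) * (t l' * star (t l'))) * t l' := by
    simp only [← mul_assoc]
    rw [ht.star_mul_self, ht.id_mul_star, mul_assoc _ (t l'), mul_assoc,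
      ht.mul_star_mul]
  rw [h1]
  simp only at h0
  rw [h0, mul_zero, zero_mul]

/-- `t_l* t_m` is a linear combination of products `t_α t_β*` with `d(l) + d(α) = d(m) + d(β)`. -/
theorem star_mul_mem_span (ht : IsCuntzKriegerFamily t) {a b c d : Λ} (l : a ⟶ b) (m : c ⟶ d) :
    star (t l) * t m ∈ Submodule.span ℂ {y | ∃ (e : Λ) (α : e ⟶ a) (β : e ⟶ c),
      deg l + deg α = deg m + deg β ∧ y = t α * star (t β)} := by
  classical
  by_cases hbd : b = d
  swap
  · rw [ht.star_mul_eq_zero_of_range_ne l m hbd]; exact zero_mem _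
  subst hbd
  -- The vertex projection between the two factors is expanded over paths of degree $d(l)\vee d(m)$,
  -- the least degree that has both $d(l)$ and $d(m)$ below it.
  have h1 : star (t l) * t m = ∑ p ∈ (RowFinite.finite_pathsInto b (deg l ⊔ deg m)).toFinset,
      (star (t l) * t p.2) * (star (t p.2) * t m) := by
    conv_lhs => rw [← ht.star_mul_id, ht.id_eq_sum b (deg l ⊔ deg m), Finset.mul_sum, Finset.sum_mul]
    simp only [mul_assoc]
  rw [h1]
  refine Submodule.sum_mem _ fun ⟨e, p⟩ hp => ?_
  have hp' : deg p = deg l ⊔ deg m := by simpa [pathsInto] using hp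
  -- Factor $p=l'\alpha$ with $d(l')=d(l)$. Either $l'=l$, and $t_l^*$ cancels it, or the ranges of
  -- $t_l$ and $t_{l'}$ are orthogonal.
  have key : ∀ {a : Λ} (l : a ⟶ b), deg l ≤ deg p → star (t l) * t p = 0 ∨
      ∃ α : e ⟶ a, deg l + deg α = deg p ∧ star (t l) * t p = t α := fun {a} l hl => by
    obtain ⟨⟨w, α, l'⟩, ⟨h1, h2, h3⟩, -⟩ := KGraph.factorization p (deg l) (deg p - deg l)
      (add_tsub_cancel_of_le hl).symm
    simp only at h1 h2 h3
    by_cases h : (⟨a, l⟩ : Σ a, a ⟶ b) = ⟨w, l'⟩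
    · cases h
      refine Or.inr ⟨α, by rw [h2, add_tsub_cancel_of_le hl], ?_⟩
      rw [← h3, ← ht.mul_of_comp, ← mul_assoc, ht.star_mul_self, ht.id_mul]
    · left
      rw [← h3, ← ht.mul_of_comp, ← mul_assoc, ht.star_mul_eq_zero_of_ne l l' h1.symm h, zero_mul]
  have hl := key l (hp' ▸ le_sup_left)
  have hm := key m (hp' ▸ le_sup_right)
  have hm' : star (t p) * t m = star (star (t m) * t p) := by simp
  rcases hl with hl | ⟨α, hα, hl⟩
  · simp only [hl, zero_mul]; exact zero_mem _
  rcases hm with hm | ⟨β, hβ, hm⟩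
  · simp only [hm', hm, star_zero, mul_zero]; exact zero_mem _
  · exact Submodule.subset_span ⟨e, α, β, hα.trans hβ.symm, by rw [hl, hm', hm]⟩

end

end IsCuntzKriegerFamily
end KGraph

/-! ### The graded components and the core -/

namespace KGraph

section

variable {k : ℕ} {Λ : Type u} [Category.{v} Λ] [KGraph k Λ] {A : Type*} [NonUnitalCStarAlgebra A]

/-- The span of the products `t_α t_β*` with `d(α) - d(β) = n`. -/
def gradedSpan (t : ∀ ⦃a b : Λ⦄, (a ⟶ b) → A) (n : Fin k → ℤ) : Submodule ℂ A :=
  Submodule.span ℂ {y | ∃ (e a b : Λ) (α : e ⟶ a) (β : e ⟶ b),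
    (∀ i, (deg α i : ℤ) - deg β i = n i) ∧ y = t α * star (t β)}

/-- The span of the products `t_α t_β*` with `d(α) = d(β) = m`. -/
def levelSpan (t : ∀ ⦃a b : Λ⦄, (a ⟶ b) → A) (m : Fin k → ℕ) : Submodule ℂ A :=
  Submodule.span ℂ {y | ∃ (e a b : Λ) (α : e ⟶ a) (β : e ⟶ b),
    deg α = m ∧ deg β = m ∧ y = t α * star (t β)}

theorem star_mem_levelSpan {t : ∀ ⦃a b : Λ⦄, (a ⟶ b) → A} {m : Fin k → ℕ} {x : A} (hx : x ∈ levelSpan t m) :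
    star x ∈ levelSpan t m := by
  induction hx using Submodule.span_induction with
  | zero => simp
  | add x₁ x₂ _ _ h₁ h₂ => rw [star_add]; exact add_mem h₁ h₂
  | smul c x _ h => rw [star_smul]; exact Submodule.smul_mem _ _ h
  | mem x hx =>
  obtain ⟨e, a, b, α, β, hα, hβ, rfl⟩ := hx
  exact Submodule.subset_span ⟨e, b, a, β, α, hβ, hα, by simp⟩

variable [RowFinite Λ] {t : ∀ ⦃a b : Λ⦄, (a ⟶ b) → A}

namespace IsCuntzKriegerFamily

/-- In $t_\beta(t_\alpha^*t_{\alpha'})t_{\beta'}^*$ the middle factor is a combination of $t_\gamma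
t_\delta^*$ with $d(\alpha)+d(\gamma)=d(\alpha')+d(\delta)$. The two degrees $n$ then cancel. -/
theorem star_mul_mem_gradedSpan (ht : IsCuntzKriegerFamily t) {n : Fin k → ℤ} {x y : A}
    (hx : x ∈ gradedSpan t n) (hy : y ∈ gradedSpan t n) : star x * y ∈ gradedSpan t 0 := by
  induction hx using Submodule.span_induction with
  | zero => simp
  | add x₁ x₂ _ _ h₁ h₂ => rw [star_add, add_mul]; exact add_mem h₁ h₂
  | smul c x _ h => rw [star_smul, smul_mul_assoc]; exact Submodule.smul_mem _ _ h
  | mem x hx =>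
  induction hy using Submodule.span_induction with
  | zero => simp
  | add x₁ x₂ _ _ h₁ h₂ => rw [mul_add]; exact add_mem h₁ h₂
  | smul c x _ h => rw [mul_smul_comm]; exact Submodule.smul_mem _ _ h
  | mem y hy =>
  obtain ⟨e, a, b, α, β, hd, rfl⟩ := hx
  obtain ⟨e', a', b', α', β', hd', rfl⟩ := hy
  have h : star (t α * star (t β)) * (t α' * star (t β')) =
      t β * (star (t α) * t α') * star (t β') := by
    simp only [star_mul, star_star, mul_assoc]
  rw [h]
  have hmem := ht.star_mul_mem_span α α'
  generalize star (t α) * t α' = z at hmem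
  induction hmem using Submodule.span_induction with
  | zero => simp
  | add x₁ x₂ _ _ h₁ h₂ => rw [mul_add, add_mul]; exact add_mem h₁ h₂
  | smul c x _ h => rw [mul_smul_comm, smul_mul_assoc]; exact Submodule.smul_mem _ _ h
  | mem z hz =>
  obtain ⟨f, γ, δ, hγδ, rfl⟩ := hz
  refine Submodule.subset_span ⟨f, _, _, γ ≫ β, δ ≫ β', fun i => ?_, ?_⟩
  · have h1 := hd i
    have h2 := hd' i
    have h3 := congrFun hγδ i
    simp only [deg_comp, Pi.add_apply, Pi.zero_apply] at h3 ⊢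
    omega
  · rw [← ht.mul_of_comp, ← ht.mul_of_comp, star_mul, mul_assoc, mul_assoc, mul_assoc]

/-- Comes from expanding the projection at the common source. It rewrites an element of one level in
terms of a higher one. -/
theorem mul_star_eq_sum (ht : IsCuntzKriegerFamily t) {e a b : Λ} (α : e ⟶ a) (β : e ⟶ b)
    (n : Fin k → ℕ) : t α * star (t β) =
      ∑ p ∈ (RowFinite.finite_pathsInto e n).toFinset, t (p.2 ≫ α) * star (t (p.2 ≫ β)) := by
  conv_lhs => rw [← ht.mul_id α, ht.id_eq_sum e n, Finset.mul_sum, Finset.sum_mul]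
  simp only [← ht.mul_of_comp, star_mul, mul_assoc]

theorem levelSpan_mono (ht : IsCuntzKriegerFamily t) : Monotone (levelSpan t) := by
  intro m n hmn
  rw [levelSpan, Submodule.span_le]
  rintro _ ⟨e, a, b, α, β, hα, hβ, rfl⟩
  rw [ht.mul_star_eq_sum α β (n - m)]
  refine Submodule.sum_mem _ fun p hp => ?_
  have hp' : deg p.2 = n - m := by simpa [pathsInto] using hp
  refine Submodule.subset_span ⟨_, _, _, _, _, ?_, ?_, rfl⟩
  · rw [deg_comp, hα, hp', add_tsub_cancel_of_le hmn]
  · rw [deg_comp, hβ, hp', add_tsub_cancel_of_le hmn]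

/-- The levels increase with $m$ and $\mathbb{N}^k$ is directed, so the finitely many terms of an
element fit into one level. -/
theorem exists_mem_levelSpan (ht : IsCuntzKriegerFamily t) {x : A} (hx : x ∈ gradedSpan t 0) :
    ∃ m, x ∈ levelSpan t m := by
  induction hx using Submodule.span_induction with
  | zero => exact ⟨0, zero_mem _⟩
  | add x₁ x₂ _ _ h₁ h₂ =>
    obtain ⟨m₁, h₁⟩ := h₁
    obtain ⟨m₂, h₂⟩ := h₂
    exact ⟨m₁ ⊔ m₂, add_mem (ht.levelSpan_mono le_sup_left h₁) (ht.levelSpan_mono le_sup_right h₂)⟩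
  | smul c x _ h =>
    obtain ⟨m, h⟩ := h
    exact ⟨m, Submodule.smul_mem _ _ h⟩
  | mem x hx =>
    obtain ⟨e, a, b, α, β, hd, rfl⟩ := hx
    refine ⟨deg α, Submodule.subset_span ⟨e, a, b, α, β, rfl, funext fun i => ?_, rfl⟩⟩
    have := hd i
    simp only [Pi.zero_apply] at this
    omega

/-- The compression of `t_α t_β*` by paths of the same degree is a multiple of a vertex projection. -/
theorem star_mul_mul_mem_span (ht : IsCuntzKriegerFamily t) {m : Fin k → ℕ} {a b a' b' : Λ}
    (l : a ⟶ b) (l' : a' ⟶ b') (hl : deg l = m) (hl' : deg l' = m) {x : A}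
    (hx : x ∈ levelSpan t m) : star (t l) * x * t l' ∈ Submodule.span ℂ {t (𝟙 a)} := by
  induction hx using Submodule.span_induction with
  | zero => simp
  | add x₁ x₂ _ _ h₁ h₂ => rw [mul_add, add_mul]; exact add_mem h₁ h₂
  | smul c x _ h => rw [mul_smul_comm, smul_mul_assoc]; exact Submodule.smul_mem _ _ h
  | mem x hx =>
  obtain ⟨e, c, d, α, β, hα, hβ, rfl⟩ := hx
  -- Two paths of equal degree either coincide, which leaves the source projection, or have
  -- orthogonal ranges.
  have key : ∀ {a b c : Λ} (l : a ⟶ b) (α : e ⟶ c), deg l = deg α → star (t l) * t α = 0 ∨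
      e = a ∧ star (t l) * t α = t (𝟙 e) := fun {a b c} l α h => by
    by_cases hbc : b = c
    · subst hbc
      by_cases hla : (⟨a, l⟩ : Σ a, a ⟶ b) = ⟨e, α⟩
      · cases hla
        exact Or.inr ⟨rfl, ht.star_mul_self α⟩
      · exact Or.inl (ht.star_mul_eq_zero_of_ne l α h hla)
    · exact Or.inl (ht.star_mul_eq_zero_of_range_ne l α hbc)
  have h : star (t l) * (t α * star (t β)) * t l' =
      (star (t l) * t α) * star (star (t l') * t β) := by
    simp only [star_mul, star_star, mul_assoc]
  rw [h]
  rcases key l α (hl.trans hα.symm) with h1 | ⟨rfl, h1⟩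
  · rw [h1, zero_mul]; exact zero_mem _
  rcases key l' β (hl'.trans hβ.symm) with h2 | ⟨rfl, h2⟩
  · rw [h2, star_zero, mul_zero]; exact zero_mem _
  · rw [h1, h2, ht.star_id, ht.mul_id]; exact Submodule.mem_span_singleton_self _

/-- The generators multiply like matrix units: $t_\beta^*t_{\alpha'}$ is the source projection if
$\beta=\alpha'$ and $0$ otherwise. -/
theorem mul_mem_levelSpan (ht : IsCuntzKriegerFamily t) {m : Fin k → ℕ} {x y : A}
    (hx : x ∈ levelSpan t m) (hy : y ∈ levelSpan t m) : x * y ∈ levelSpan t m := by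
  induction hx using Submodule.span_induction with
  | zero => simp
  | add x₁ x₂ _ _ h₁ h₂ => rw [add_mul]; exact add_mem h₁ h₂
  | smul c x _ h => rw [smul_mul_assoc]; exact Submodule.smul_mem _ _ h
  | mem x hx =>
  induction hy using Submodule.span_induction with
  | zero => simp
  | add x₁ x₂ _ _ h₁ h₂ => rw [mul_add]; exact add_mem h₁ h₂
  | smul c x _ h => rw [mul_smul_comm]; exact Submodule.smul_mem _ _ h
  | mem y hy =>
  obtain ⟨e, a, b, α, β, hα, hβ, rfl⟩ := hx
  obtain ⟨e', a', b', α', β', hα', hβ', rfl⟩ := hy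
  have h : t α * star (t β) * (t α' * star (t β')) = t α * (star (t β) * t α') * star (t β') := by
    simp only [mul_assoc]
  rw [h]
  by_cases hb : b = a'
  · subst hb
    by_cases hba : (⟨e, β⟩ : Σ a, a ⟶ b) = ⟨e', α'⟩
    · cases hba
      rw [ht.star_mul_self, ht.mul_id]
      exact Submodule.subset_span ⟨_, _, _, α, β', hα, hβ', rfl⟩
    · rw [ht.star_mul_eq_zero_of_ne β α' (hβ.trans hα'.symm) hba]; simp
  · rw [ht.star_mul_eq_zero_of_range_ne β α' hb]; simp

/-- The `*`-subalgebra spanned by the products `t_α t_β*` with `d(α) = d(β) = m`. -/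
def levelSubalgebra (ht : IsCuntzKriegerFamily t) (m : Fin k → ℕ) :
    NonUnitalStarSubalgebra ℂ A where
  __ := levelSpan t m
  mul_mem' := ht.mul_mem_levelSpan
  star_mem' := star_mem_levelSpan

variable {B : Type*} [NonUnitalCStarAlgebra B]

/-- Each matrix entry $t_l^*xt_{l'}$ is a scalar multiple of a vertex projection. As $\varphi$ kills
the entry but not the projection, the scalar is $0$, and an element whose entries all vanish is $0$.
-/
theorem eq_zero_of_mem_closure_level (ht : IsCuntzKriegerFamily t) (φ : A →⋆ₙₐ[ℂ] B)
    (hφ : ∀ w : Λ, φ (t (𝟙 w)) ≠ 0) {m : Fin k → ℕ} {x : A}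
    (hx : x ∈ (ht.levelSubalgebra m).topologicalClosure) (h0 : φ x = 0) : x = 0 := by
  have hx' : x ∈ closure (levelSpan t m : Set A) := hx
  have hsx : star x ∈ closure (levelSpan t m : Set A) :=
    star_mem (s := (ht.levelSubalgebra m).topologicalClosure) hx
  have h1 : ∀ {a b a' b' : Λ} (l : a ⟶ b) (l' : a' ⟶ b'), deg l = m → deg l' = m →
      star (t l) * x * t l' = 0 := fun {a b a' b'} l l' hl hl' => by
    have hmem : star (t l) * x * t l' ∈ Submodule.span ℂ {t (𝟙 a)} := by
      -- A line is closed, so the description of the entries passes from the span to its closure.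
      have hcl : IsClosed (Submodule.span ℂ {t (𝟙 a)} : Set A) :=
        Submodule.closed_of_finiteDimensional _
      refine closure_minimal (t := {y | star (t l) * y * t l' ∈ Submodule.span ℂ {t (𝟙 a)}})
        (fun y hy => ht.star_mul_mul_mem_span l l' hl hl' hy)
        (hcl.preimage ((continuous_const.mul continuous_id).mul continuous_const)) hx'
    obtain ⟨c, hc⟩ := Submodule.mem_span_singleton.1 hmem
    have h2 : φ (c • t (𝟙 a)) = 0 := by rw [hc, map_mul, map_mul, h0, mul_zero, zero_mul]
    rw [map_smul, smul_eq_zero, or_iff_left (hφ a)] at h2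
    rw [← hc, h2, zero_smul]
  -- The vanishing entries give $y\,x\,t_l=0$ for every $y$ in the closed level; the choice $y=x^*$
  -- gives $(xt_l)^*(xt_l)=0$.
  have h2 : ∀ {a b : Λ} (l : a ⟶ b), deg l = m → x * t l = 0 := fun {a b} l hl => by
    have h : ∀ y ∈ closure (levelSpan t m : Set A), y * (x * t l) = 0 := fun y hy => by
      refine closure_minimal (t := {y | y * (x * t l) = 0}) (fun y hy => ?_)
        (isClosed_eq (continuous_id.mul continuous_const) continuous_const) hy
      induction hy using Submodule.span_induction with
      | zero => exact zero_mul _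
      | add y₁ y₂ _ _ h₁ h₂ =>
        rw [Set.mem_ofPred_eq] at h₁ h₂ ⊢
        rw [add_mul, h₁, h₂, add_zero]
      | smul c y _ h =>
        rw [Set.mem_ofPred_eq] at h ⊢
        rw [smul_mul_assoc, h, smul_zero]
      | mem y hy =>
        obtain ⟨e, c, d, α, β, hα, hβ, rfl⟩ := hy
        rw [Set.mem_ofPred_eq, mul_assoc, ← mul_assoc (star (t β)), h1 β l hβ hl, mul_zero]
    rw [← CStarRing.star_mul_self_eq_zero_iff, star_mul, mul_assoc, h _ hsx, mul_zero]
  -- Now $x$ annihilates the whole closed level from the left, and $x^*$ belongs to it.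
  rw [← CStarRing.mul_star_self_eq_zero_iff]
  refine closure_minimal (t := {y | x * y = 0}) (fun y hy => ?_)
    (isClosed_eq (continuous_const.mul continuous_id) continuous_const) hsx
  induction hy using Submodule.span_induction with
  | zero => exact mul_zero _
  | add y₁ y₂ _ _ h₁ h₂ =>
    rw [Set.mem_ofPred_eq] at h₁ h₂ ⊢
    rw [mul_add, h₁, h₂, add_zero]
  | smul c y _ h =>
    rw [Set.mem_ofPred_eq] at h ⊢
    rw [mul_smul_comm, h, smul_zero]
  | mem y hy =>
    obtain ⟨e, c, d, α, β, hα, hβ, rfl⟩ := hy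
    rw [Set.mem_ofPred_eq, ← mul_assoc, h2 α hα, zero_mul]

/-- An injective $*$-homomorphism of $C^*$-algebras is isometric. Applied to each closed level, this
gives equality of norms on a dense subset of the core. -/
theorem norm_map_of_mem_closure_gradedSpan (ht : IsCuntzKriegerFamily t) (φ : A →⋆ₙₐ[ℂ] B)
    (hφ : ∀ w : Λ, φ (t (𝟙 w)) ≠ 0) {x : A} (hx : x ∈ closure (gradedSpan t 0 : Set A)) :
    ‖φ x‖ = ‖x‖ := by
  have hcont := continuous_nonUnitalStarAlgHom φ
  refine closure_minimal (t := {y | ‖φ y‖ = ‖y‖}) (fun y hy => ?_)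
    (isClosed_eq hcont.norm continuous_norm) hx
  obtain ⟨m, hm⟩ := ht.exists_mem_levelSpan hy
  let S := (ht.levelSubalgebra m).topologicalClosure
  have : IsClosed (S : Set A) := (ht.levelSubalgebra m).isClosed_topologicalClosure
  let ψ : S →⋆ₙₐ[ℂ] B := φ.comp (NonUnitalStarSubalgebraClass.subtype S)
  have hψ : Function.Injective ψ := (injective_iff_map_eq_zero ψ).2 fun y hy =>
    Subtype.ext (ht.eq_zero_of_mem_closure_level φ hφ y.2 hy)
  exact NonUnitalStarAlgHom.norm_map ψ hψ ⟨y, subset_closure hm⟩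

end IsCuntzKriegerFamily

end

end KGraph

/-! ### Fourier coefficients of vector-valued functions on the torus -/

namespace UnitAddTorus

open MeasureTheory

attribute [local instance] instMeasureSpaceUnitAddCircle

theorem isProbabilityMeasure_volume_unitAddCircle :
    IsProbabilityMeasure (volume : Measure UnitAddCircle) :=
  inferInstanceAs (IsProbabilityMeasure AddCircle.haarAddCircle)

attribute [local instance] isProbabilityMeasure_volume_unitAddCircle

variable {d : Type*} [Fintype d] {E : Type*} [NormedAddCommGroup E] [NormedSpace ℂ E]

theorem integrable_mFourier_smul {f : UnitAddTorus d → E} (hf : Continuous f) (n : d → ℤ) :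
    Integrable (fun z => mFourier n z • f z) :=
  ((mFourier n).continuous.smul hf).integrable_of_hasCompactSupport (.of_compactSpace _)

theorem map_mFourierCoeff [CompleteSpace E] {G : Type*} [NormedAddCommGroup G] [NormedSpace ℂ G]
    [CompleteSpace G] (L : E →L[ℂ] G) {f : UnitAddTorus d → E} (hf : Continuous f) (n : d → ℤ) :
    L (mFourierCoeff f n) = mFourierCoeff (fun z => L (f z)) n := by
  rw [mFourierCoeff, ← L.integral_comp_comm (integrable_mFourier_smul hf _)]
  simp only [map_smul]
  rfl

/-- This is orthonormality of the characters, read off from their inner products in $L^2$. -/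
theorem mFourierCoeff_mFourier_smul [CompleteSpace E] [DecidableEq (d → ℤ)] (m n : d → ℤ) (y : E) :
    mFourierCoeff (fun z => mFourier m z • y) n = if m = n then y else 0 := by
  have h := orthonormal_iff_ite.1 (orthonormal_mFourier (d := d)) n m
  simp only [ContinuousMap.inner_toLp, ← mFourier_neg, ← mFourier_add] at h
  have h' : ∀ z, mFourier (-n) z • mFourier m z • y = mFourier (m + -n) z • y := fun z => by
    rw [smul_smul, ← mFourier_add, add_comm]
  rw [mFourierCoeff, integral_congr_ae (.of_forall h'), integral_smul_const, h]
  simp only [eq_comm (a := n), ite_smul, one_smul, zero_smul]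

/-- A continuous function on the torus is determined by its Fourier coefficients. -/
theorem eq_zero_of_mFourierCoeff_eq_zero [CompleteSpace E] {f : UnitAddTorus d → E}
    (hf : Continuous f) (h : ∀ n, mFourierCoeff f n = 0) (z : UnitAddTorus d) : f z = 0 := by
  refine SeparatingDual.eq_zero_of_forall_dual_eq_zero (R := ℂ) fun L => ?_
  let g : C(UnitAddTorus d, ℂ) := ⟨fun z => L (f z), L.continuous.comp hf⟩
  have hg : mFourierCoeff g = 0 := funext fun n => by
    change mFourierCoeff (fun z => L (f z)) n = 0
    rw [← map_mFourierCoeff L hf, h, map_zero]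
  -- Zero coefficients are summable, so the Fourier series of the scalar function `g` converges to
  -- it at every point.
  have hs := hasSum_mFourier_series_apply_of_summable (f := g) (hg ▸ summable_zero) z
  simp only [hg, Pi.zero_apply, zero_smul] at hs
  exact hs.unique hasSum_zero

theorem norm_mFourierCoeff_le {f : UnitAddTorus d → E} {C : ℝ} (h : ∀ z, ‖f z‖ ≤ C) (n : d → ℤ) :
    ‖mFourierCoeff f n‖ ≤ C := by
  refine (norm_integral_le_of_norm_le_const (C := C) (.of_forall fun z => ?_)).trans_eq (by simp)
  refine (norm_smul_le _ _).trans ?_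
  refine (mul_le_mul_of_nonneg_right ((mFourier (-n)).norm_coe_le_norm z) (norm_nonneg _)).trans ?_
  rw [mFourier_norm, one_mul]
  exact h z

end UnitAddTorus

/-! ### The gauge action on `C*(Λ)` and its spectral subspaces -/

namespace KGraph

open UnitAddTorus

section

variable {k : ℕ} {Λ : Type u} [Category.{v} Λ] [KGraph k Λ]

/-- The character of the torus defined by the degree of a path. -/
noncomputable def degChar {a b : Λ} (l : a ⟶ b) (z : UnitAddTorus (Fin k)) : ℂ :=
  mFourier (fun i => (deg l i : ℤ)) z

theorem degChar_id (a : Λ) (z : UnitAddTorus (Fin k)) : degChar (𝟙 a) z = 1 := by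
  have : (fun i => ((deg (𝟙 a) i : ℕ) : ℤ)) = 0 := by funext i; simp [deg_id]
  rw [degChar, this, mFourier_zero]; rfl

theorem degChar_comp {a b c : Λ} (n : a ⟶ b) (m : b ⟶ c) (z : UnitAddTorus (Fin k)) :
    degChar (n ≫ m) z = degChar m z * degChar n z := by
  rw [degChar, degChar, degChar, ← mFourier_add]
  congr 2
  funext i; simp [deg_comp]

theorem degChar_mul_conj {a b c d : Λ} (l : a ⟶ b) (m : c ⟶ d) (z : UnitAddTorus (Fin k)) :
    degChar l z * conj (degChar m z) = mFourier (fun i => (deg l i : ℤ) - deg m i) z := by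
  rw [degChar, degChar, ← mFourier_neg, ← mFourier_add]
  congr 2

theorem degChar_mul_conj_of_eq {a b c d : Λ} {l : a ⟶ b} {m : c ⟶ d} (h : deg l = deg m)
    (z : UnitAddTorus (Fin k)) : degChar l z * conj (degChar m z) = 1 := by
  have : (fun i => (deg l i : ℤ) - deg m i) = 0 := by funext i; simp [h]
  rw [degChar_mul_conj, this, mFourier_zero]; rfl

variable [RowFinite Λ] {A : Type*} [NonUnitalCStarAlgebra A] {t : ∀ ⦃a b : Λ⦄, (a ⟶ b) → A}

/-- The scalars are unimodular and multiplicative along paths, so the relations are preserved. The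
universal property then turns this family into the gauge action. -/
theorem IsCuntzKriegerFamily.degChar_smul (ht : IsCuntzKriegerFamily t)
    (z : UnitAddTorus (Fin k)) :
    IsCuntzKriegerFamily fun a b (l : a ⟶ b) => degChar l z • t l := by
  have hc : ∀ {a b : Λ} (l : a ⟶ b), conj (degChar l z) * degChar l z = 1 := fun l => by
    rw [mul_comm, degChar_mul_conj_of_eq rfl]
  intro x y h
  cases h with
  | partial_isometry l =>
    simp only [star_smul, smul_mul_smul_comm, ht.mul_star_mul]
    rw [RCLike.star_def, mul_assoc, hc, mul_one]
  | vertex_star w => simp only [degChar_id, one_smul, ht.star_id]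
  | vertex_idem w => simp only [degChar_id, one_smul, ht.mul_id]
  | vertex_orth h => simp only [degChar_id, one_smul, ht.id_mul_id_of_ne h]
  | mul ν μ => simp only [smul_mul_smul_comm, ht.mul_of_comp, degChar_comp]
  | star_mul l =>
    simp only [star_smul, smul_mul_smul_comm, ht.star_mul_self, degChar_id, one_smul]
    rw [RCLike.star_def, hc, one_smul]
  | sum w n =>
    simp only [star_smul, smul_mul_smul_comm, degChar_id, one_smul]
    simp only [RCLike.star_def, degChar_mul_conj_of_eq rfl, one_smul]
    exact ht.id_eq_sum w n

variable (Λ) in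
/-- The span of the products `t_α t_β*` is dense in `C*(Λ)`. -/
theorem dense_span_mul_star : Dense (Submodule.span ℂ {y : CStar Λ |
    ∃ (e a b : Λ) (α : e ⟶ a) (β : e ⟶ b), y = univ α * star (univ β)} : Set (CStar Λ)) := by
  have ht := isCuntzKriegerFamily_univ (Λ := Λ)
  set S := Submodule.span ℂ {y : CStar Λ |
    ∃ (e a b : Λ) (α : e ⟶ a) (β : e ⟶ b), y = univ α * star (univ β)} with hS
  have hmul : ∀ {a b : Λ} (l : a ⟶ b), ∀ y ∈ S, univ l * y ∈ S := fun {a b} l y hy => by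
    induction hy using Submodule.span_induction with
    | zero => simp
    | add x₁ x₂ _ _ h₁ h₂ => rw [mul_add]; exact add_mem h₁ h₂
    | smul c x _ h => rw [mul_smul_comm]; exact Submodule.smul_mem _ _ h
    | mem y hy =>
    obtain ⟨e, c, d, α, β, rfl⟩ := hy
    by_cases h : a = c
    · subst h
      rw [← mul_assoc, ht.mul_of_comp]
      exact Submodule.subset_span ⟨_, _, _, _, _, rfl⟩
    · rw [← mul_assoc, ht.mul_eq_zero_of_source_ne l α h, zero_mul]; exact zero_mem _
  have hsmul : ∀ {a b : Λ} (l : a ⟶ b), ∀ y ∈ S, star (univ l) * y ∈ S := fun {a b} l y hy => by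
    induction hy using Submodule.span_induction with
    | zero => simp
    | add x₁ x₂ _ _ h₁ h₂ => rw [mul_add]; exact add_mem h₁ h₂
    | smul c x _ h => rw [mul_smul_comm]; exact Submodule.smul_mem _ _ h
    | mem y hy =>
    obtain ⟨e, c, d, α, β, rfl⟩ := hy
    rw [← mul_assoc]
    have hmem := ht.star_mul_mem_span l α
    generalize star (univ l) * univ α = w at hmem
    induction hmem using Submodule.span_induction with
    | zero => simp
    | add x₁ x₂ _ _ h₁ h₂ => rw [add_mul]; exact add_mem h₁ h₂
    | smul c x _ h => rw [smul_mul_assoc]; exact Submodule.smul_mem _ _ h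
    | mem w hw =>
      obtain ⟨f, γ, δ, -, rfl⟩ := hw
      rw [mul_assoc, ← star_mul, ht.mul_of_comp]
      exact Submodule.subset_span ⟨_, _, _, _, _, rfl⟩
  -- The span contains the images of all letters and is stable under left multiplication by them. It
  -- therefore contains the images of all words, which span a dense subspace.
  let ι := CStarSeminorm.Envelope.ιHom (ckSeminorm Λ)
  have hof : ∀ p, ι (FreeStarAlg.mono (FreeSemigroup.of p) 1) ∈ S ∧
      ∀ y ∈ S, ι (FreeStarAlg.mono (FreeSemigroup.of p) 1) * y ∈ S := by
    rintro ⟨⟨a, b, l⟩, _ | _⟩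
    · refine ⟨Submodule.subset_span ⟨a, b, a, l, 𝟙 a, ?_⟩, fun y hy => hmul l y hy⟩
      rw [ht.star_id, ht.mul_id]; rfl
    · rw [FreeStarAlg.mono_of_true, map_star]
      refine ⟨Submodule.subset_span ⟨a, a, b, 𝟙 a, l, ?_⟩, fun y hy => hsmul l y hy⟩
      rw [ht.id_mul_star]; rfl
  have hw : ∀ w, ι (FreeStarAlg.mono w 1) ∈ S := fun w => by
    induction w with
    | ih1 p => exact (hof p).1
    | ih2 p w _ h =>
      have : FreeStarAlg.mono (FreeSemigroup.of p * w) 1 =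
          FreeStarAlg.mono (FreeSemigroup.of p) 1 * FreeStarAlg.mono w 1 := by
        rw [FreeStarAlg.mono_mul, one_mul]
      rw [this, map_mul]
      exact (hof p).2 _ h
  refine (CStarSeminorm.Envelope.denseRange_ι (N := ckSeminorm Λ)).mono ?_
  rintro _ ⟨f, rfl⟩
  change ι f ∈ S
  induction f using FreeStarAlg.ind with
  | hm w c =>
    have : FreeStarAlg.mono w c = c • FreeStarAlg.mono w 1 := by
      rw [FreeStarAlg.smul_mono, mul_one]
    rw [this, map_smul]
    exact S.smul_mem c (hw w)
  | h0 => rw [map_zero]; exact zero_mem _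
  | ha f g hf hg => rw [map_add]; exact add_mem hf hg

/-- The gauge action of the torus on `C*(Λ)`. -/
noncomputable def gauge (z : UnitAddTorus (Fin k)) : CStar Λ →⋆ₙₐ[ℂ] CStar Λ :=
  (existsUnique_lift _ (isCuntzKriegerFamily_univ.degChar_smul z)).choose

theorem gauge_univ (z : UnitAddTorus (Fin k)) {a b : Λ} (l : a ⟶ b) :
    gauge z (univ l) = degChar l z • univ l :=
  (existsUnique_lift _ (isCuntzKriegerFamily_univ.degChar_smul z)).choose_spec.1 l

theorem gauge_mul_star (z : UnitAddTorus (Fin k)) {e a b : Λ} (α : e ⟶ a) (β : e ⟶ b) :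
    gauge z (univ α * star (univ β)) =
      mFourier (fun i => (deg α i : ℤ) - deg β i) z • (univ α * star (univ β)) := by
  rw [map_mul, map_star, gauge_univ, gauge_univ, star_smul, smul_mul_smul_comm, RCLike.star_def,
    degChar_mul_conj]

theorem eq_of_forall_mul_star {E : Type*} [TopologicalSpace E] [AddCommMonoid E] [Module ℂ E]
    [T2Space E] {f g : CStar Λ →L[ℂ] E} (h : ∀ {e a b : Λ} (α : e ⟶ a) (β : e ⟶ b),
      f (univ α * star (univ β)) = g (univ α * star (univ β))) : f = g := by
  refine ContinuousLinearMap.ext_on (dense_span_mul_star Λ) ?_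
  rintro _ ⟨e, a, b, α, β, rfl⟩
  exact h α β

theorem gauge_zero (x : CStar Λ) : gauge (0 : UnitAddTorus (Fin k)) x = x := by
  let f : CStar Λ →L[ℂ] CStar Λ :=
    ⟨(gauge (0 : UnitAddTorus (Fin k)) : CStar Λ →⋆ₙₐ[ℂ] CStar Λ),
      continuous_nonUnitalStarAlgHom _⟩
  have : f = ContinuousLinearMap.id ℂ _ := eq_of_forall_mul_star fun α β => by
    change gauge 0 _ = _
    rw [gauge_mul_star]
    simp [mFourier]
  exact congrArg (fun g : CStar Λ →L[ℂ] CStar Λ => g x) this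

/-- On the dense span this is continuity of characters. Since $*$-homomorphisms are contractive, an
approximation of $x$ there is uniform in $z$. -/
theorem continuous_gauge (x : CStar Λ) :
    Continuous fun z : UnitAddTorus (Fin k) => gauge z x := by
  have hspan : ∀ y ∈ Submodule.span ℂ {y : CStar Λ |
      ∃ (e a b : Λ) (α : e ⟶ a) (β : e ⟶ b), y = univ α * star (univ β)},
      Continuous fun z : UnitAddTorus (Fin k) => gauge z y := fun y hy => by
    induction hy using Submodule.span_induction with
    | zero => simp only [map_zero]; exact continuous_const
    | add x₁ x₂ _ _ h₁ h₂ => simp only [map_add]; exact h₁.add h₂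
    | smul c x _ h => simp only [map_smul]; exact h.const_smul c
    | mem y hy =>
      obtain ⟨e, a, b, α, β, rfl⟩ := hy
      simp only [gauge_mul_star]
      exact (mFourier _).continuous.smul continuous_const
  refine continuous_of_uniform_approx_of_continuous fun u hu => ?_
  obtain ⟨ε, hε, hu⟩ := Metric.mem_uniformity_dist.1 hu
  obtain ⟨y, hy, hxy⟩ := Metric.dense_iff.1 (dense_span_mul_star Λ) x ε hε
  refine ⟨_, hspan _ hxy, fun z => hu ?_⟩
  rw [dist_eq_norm, ← map_sub]
  refine (NonUnitalStarAlgHom.norm_apply_le _ _).trans_lt ?_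
  rw [← dist_eq_norm, dist_comm]
  exact hy

/-- The projection of `C*(Λ)` onto the spectral subspace of degree `n` of the gauge action. -/
noncomputable def spectralPart (n : Fin k → ℤ) : CStar Λ →L[ℂ] CStar Λ :=
  LinearMap.mkContinuous
    { toFun := fun x => mFourierCoeff (fun z => gauge z x) n
      map_add' := fun x y => by
        simp only [mFourierCoeff, map_add, smul_add]
        exact MeasureTheory.integral_add (integrable_mFourier_smul (continuous_gauge x) _)
          (integrable_mFourier_smul (continuous_gauge y) _)
      map_smul' := fun c x => by
        simp only [mFourierCoeff, map_smul, RingHom.id_apply]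
        rw [← MeasureTheory.integral_smul]
        simp only [smul_comm c] } 1
    fun x => by
      rw [one_mul]
      exact norm_mFourierCoeff_le (fun z => NonUnitalStarAlgHom.norm_apply_le _ _) n

theorem spectralPart_apply (n : Fin k → ℤ) (x : CStar Λ) :
    spectralPart n x = mFourierCoeff (fun z => gauge z x) n := rfl

theorem spectralPart_mul_star (n : Fin k → ℤ) {e a b : Λ} (α : e ⟶ a) (β : e ⟶ b) :
    spectralPart n (univ α * star (univ β)) =
      if (fun i => (deg α i : ℤ) - deg β i) = n then univ α * star (univ β) else 0 := by
  simp only [spectralPart_apply, gauge_mul_star, mFourierCoeff_mFourier_smul]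

/-- The projection either fixes or kills each $t_\alpha t_\beta^*$, and these products span a dense
subspace. -/
theorem spectralPart_mem (n : Fin k → ℤ) (x : CStar Λ) :
    spectralPart n x ∈ closure (gradedSpan (univ (Λ := Λ)) n : Set (CStar Λ)) := by
  have h : (spectralPart (Λ := Λ) n) '' Submodule.span ℂ {y : CStar Λ |
      ∃ (e a b : Λ) (α : e ⟶ a) (β : e ⟶ b), y = univ α * star (univ β)} ⊆
      gradedSpan (univ (Λ := Λ)) n := by
    rintro _ ⟨y, hy, rfl⟩
    induction hy using Submodule.span_induction with
    | zero => simp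
    | add x₁ x₂ _ _ h₁ h₂ => rw [map_add]; exact add_mem h₁ h₂
    | smul c x _ h => rw [map_smul]; exact Submodule.smul_mem _ _ h
    | mem y hy =>
      obtain ⟨e, a, b, α, β, rfl⟩ := hy
      rw [spectralPart_mul_star]
      split_ifs with h
      · exact Submodule.subset_span ⟨e, a, b, α, β, congrFun h, rfl⟩
      · exact zero_mem _
  exact closure_mono h (image_closure_subset_closure_image (spectralPart n).continuous
    ⟨x, dense_span_mul_star Λ x, rfl⟩)

theorem eq_zero_of_spectralPart_eq_zero {x : CStar Λ}
    (h : ∀ n : Fin k → ℤ, spectralPart n x = 0) : x = 0 := by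
  -- The torus is written additively, so $x$ is the value at $0$ of its own orbit function, whose
  -- Fourier coefficients are the spectral parts.
  rw [← gauge_zero x]
  exact eq_zero_of_mFourierCoeff_eq_zero (continuous_gauge x) h 0

/-- A `*`-homomorphism which does not annihilate any vertex projection and whose kernel is graded
is injective. -/
theorem injective_of_spectralPart {B : Type*} [NonUnitalCStarAlgebra B] (φ : CStar Λ →⋆ₙₐ[ℂ] B)
    (hφ : ∀ w : Λ, φ (univ (𝟙 w)) ≠ 0)
    (hgr : ∀ x, φ x = 0 → ∀ n : Fin k → ℤ, φ (spectralPart n x) = 0) : Function.Injective φ := by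
  have ht := isCuntzKriegerFamily_univ (Λ := Λ)
  refine (injective_iff_map_eq_zero φ).2 fun x hx =>
    eq_zero_of_spectralPart_eq_zero fun n : Fin k → ℤ => ?_
  have hy := spectralPart_mem n x
  have h0 := hgr x hx n
  generalize spectralPart n x = y at hy h0
  have hmem : star y * y ∈ closure (gradedSpan (univ (Λ := Λ)) 0 : Set (CStar Λ)) :=
    map_mem_closure₂ (f := fun a b : CStar Λ => star a * b)
      ((continuous_star.comp continuous_fst).mul continuous_snd) hy hy
      fun a ha b hb => ht.star_mul_mem_gradedSpan ha hb
  rw [← CStarRing.star_mul_self_eq_zero_iff, ← norm_eq_zero,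
    ← ht.norm_map_of_mem_closure_gradedSpan φ hφ hmem, map_mul, h0, mul_zero, norm_zero]

end

end KGraph

/-! ### The prefixing operators on `H_x` -/

namespace HilbertLimit

variable {I : Type*} [Preorder I] [IsDirectedOrder I] {E : I → Type*}
  [∀ i, NormedAddCommGroup (E i)] [∀ i, InnerProductSpace ℂ (E i)]
  (f : ∀ i j, i ≤ j → E i →ₗᵢ[ℂ] E j) [DirectedSystem E (f · · ·)] [Nonempty I]

theorem inner_mk (i : I) (a b : E i) : inner ℂ (mk f i a) (mk f i b) = inner ℂ a b := by
  rw [mk, mk, UniformSpace.Completion.inner_coe]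
  exact AlgLimit.inner_mk f i a b

theorem mk_map {i j : I} (h : i ≤ j) (a : E i) : mk f j (f i j h a) = mk f i a :=
  congrArg _ (AlgLimit.mk_map f h a)

/-- The canonical isometry of the `i`-th space into the inductive limit. -/
noncomputable def mkₗᵢ (i : I) : E i →ₗᵢ[ℂ] HilbertLimit f :=
  LinearMap.isometryOfInner
    { toFun := mk f i
      map_add' := fun a b => by
        rw [mk, AlgLimit.mk_add, UniformSpace.Completion.coe_add]; rfl
      map_smul' := fun c a => by
        rw [mk, AlgLimit.mk_smul, UniformSpace.Completion.coe_smul]; rfl }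
    (inner_mk f i)

theorem clm_ext {G : Type*} [TopologicalSpace G] [AddCommMonoid G] [Module ℂ G] [T2Space G]
    {S T : HilbertLimit f →L[ℂ] G} (h : ∀ i a, S (mk f i a) = T (mk f i a)) : S = T := by
  ext y
  refine UniformSpace.Completion.induction_on y (isClosed_eq S.continuous T.continuous) fun y => ?_
  exact AlgLimit.ind f (P := fun y => S (UniformSpace.Completion.coe' y) =
    T (UniformSpace.Completion.coe' y)) h y

end HilbertLimit

namespace KGraph

section Factorization

variable {k : ℕ} {Λ : Type u} [Category.{v} Λ] [KGraph k Λ]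

theorem factorization_unique {a b b' c : Λ} {f : a ⟶ b} {l : b ⟶ c} {f' : a ⟶ b'} {l' : b' ⟶ c}
    (h : f ≫ l = f' ≫ l') (hd : deg l = deg l') :
    (⟨b, f, l⟩ : Σ b : Λ, (a ⟶ b) × (b ⟶ c)) = ⟨b', f', l'⟩ := by
  have hd' : deg f = deg f' := by
    have : deg (f ≫ l) = deg (f' ≫ l') := by rw [h]
    rw [deg_comp, deg_comp, hd] at this
    exact add_left_cancel this
  exact (KGraph.factorization (f ≫ l) (deg l) (deg f) (deg_comp _ _)).unique ⟨rfl, rfl, rfl⟩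
    ⟨hd.symm, hd'.symm, h.symm⟩

theorem comp_right_cancel {k : ℕ} {Λ : Type u} [Category.{v} Λ] [KGraph k Λ] {a b c : Λ} {f g : a ⟶ b} {l : b ⟶ c}
    (h : f ≫ l = g ≫ l) : f = g := by
  simpa using factorization_unique h rfl

end Factorization

/-! ### The basis vectors of $\mathcal{H}_x$, construction of the prefixing operators, separability
-/

namespace InfinitePath

variable {k : ℕ} {Λ : Type u} [Category.{v} Λ] [KGraph k Λ] (x : InfinitePath Λ)

theorem clm_ext {G : Type*} [NormedAddCommGroup G] [NormedSpace ℂ G] {S T : x.H →L[ℂ] G}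
    (h : ∀ i w (μ : x.vertex i ⟶ w), S (x.ξ i μ) = T (x.ξ i μ)) : S = T := by
  refine HilbertLimit.clm_ext x.trans fun i a => ?_
  have : S ∘L (HilbertLimit.mkₗᵢ x.trans i).toContinuousLinearMap =
      T ∘L (HilbertLimit.mkₗᵢ x.trans i).toContinuousLinearMap :=
    x.ext_basisVec fun μ => h i μ.1 μ.2
  exact congrArg (fun R : x.L2 i →L[ℂ] G => R a) this

/-- Used throughout to bring two basis vectors to a common stage of the limit, where they belong to
one orthonormal basis. -/
theorem ξ_segment {i j : ℕ} (h : i ≤ j) {w : Λ} (μ : x.vertex i ⟶ w) :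
    x.ξ j (x.segment h ≫ μ) = x.ξ i μ := by
  rw [ξ, ξ, ← HilbertLimit.mk_map x.trans h (x.basisVec i ⟨w, μ⟩), trans_basisVec]
  rfl

open Classical in
theorem inner_ξ (i : ℕ) {w w' : Λ} (μ : x.vertex i ⟶ w) (μ' : x.vertex i ⟶ w') :
    inner ℂ (x.ξ i μ) (x.ξ i μ') = if (⟨w, μ⟩ : x.F i) = ⟨w', μ'⟩ then (1 : ℂ) else 0 := by
  rw [ξ, ξ, HilbertLimit.inner_mk, basisVec, basisVec, lp.inner_single_left]
  simp [lp.single_apply, Pi.single_apply]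

theorem norm_ξ (i : ℕ) {w : Λ} (μ : x.vertex i ⟶ w) : ‖x.ξ i μ‖ = 1 := by
  have h := inner_self_eq_norm_sq_to_K (𝕜 := ℂ) (x.ξ i μ)
  rw [inner_ξ, if_pos rfl] at h
  have h' : (‖x.ξ i μ‖ : ℂ) ^ 2 = 1 := h.symm
  norm_cast at h'
  nlinarith [norm_nonneg (x.ξ i μ)]


theorem inner_ξ_of_ne (i j : ℕ) {w w' : Λ} (h : w ≠ w') (μ : x.vertex i ⟶ w)
    (ν : x.vertex j ⟶ w') : inner ℂ (x.ξ i μ) (x.ξ j ν) = (0 : ℂ) := by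
  rw [← x.ξ_segment (le_max_left i j), ← x.ξ_segment (le_max_right i j), inner_ξ, if_neg]
  exact fun h' => h (congrArg Sigma.fst h')

/-- At a common stage both inner products record whether two paths coincide, and prefixing by `l` is
injective by unique factorization. -/
theorem inner_ξ_comp (i j : ℕ) {a b : Λ} (l : a ⟶ b) (μ : x.vertex i ⟶ a) (ν : x.vertex j ⟶ a) :
    inner ℂ (x.ξ i (μ ≫ l)) (x.ξ j (ν ≫ l)) = (inner ℂ (x.ξ i μ) (x.ξ j ν) : ℂ) := by
  classical
  simp only [← x.ξ_segment (le_max_left i j), ← x.ξ_segment (le_max_right i j), inner_ξ,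
    ← Category.assoc]
  refine if_congr ⟨fun h => ?_, fun h => ?_⟩ rfl rfl
  · simp only [Sigma.mk.injEq, heq_eq_eq, true_and] at h ⊢
    exact comp_right_cancel h
  · simp only [Sigma.mk.injEq, heq_eq_eq, true_and] at h ⊢
    rw [h]

theorem inner_ξ_eq_zero_of_ne (i j : ℕ) {w w' : Λ} (μ : x.vertex i ⟶ w) (ν : x.vertex j ⟶ w')
    (h : x.ξ i μ ≠ x.ξ j ν) : inner ℂ (x.ξ i μ) (x.ξ j ν) = (0 : ℂ) := by
  classical
  rw [← x.ξ_segment (le_max_left i j), ← x.ξ_segment (le_max_right i j)] at h ⊢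
  rw [inner_ξ, if_neg]
  intro h'
  obtain rfl : w = w' := congrArg Sigma.fst h'
  simp only [Sigma.mk.injEq, heq_eq_eq, true_and] at h'
  exact h (by rw [h'])

/-- The basis vectors of `H_x` attached to the paths of range `w`. -/
def basisSet (w : Λ) : Set x.H := {h | ∃ (i : ℕ) (μ : x.vertex i ⟶ w), x.ξ i μ = h}

/-- The vector `[ξ^i_μ]` as an element of `basisSet`. -/
noncomputable def basisElt (i : ℕ) {w : Λ} (μ : x.vertex i ⟶ w) : x.basisSet w :=
  ⟨x.ξ i μ, i, μ, rfl⟩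

theorem basisSet_cases {w : Λ} (h : x.basisSet w) :
    ∃ (i : ℕ) (μ : x.vertex i ⟶ w), h = x.basisElt i μ := by
  obtain ⟨_, i, μ, rfl⟩ := h
  exact ⟨i, μ, rfl⟩

/-- One vector of $\mathcal{H}_x$ is represented by many pairs $(i,\mu)$, so the orthonormal family
is indexed by the vectors themselves. Prefixing is well defined on them because it preserves inner
products, and unit vectors with inner product $1$ are equal. -/
theorem exists_orthonormal_prefix {a b : Λ} (l : a ⟶ b) :
    ∃ g : x.basisSet a → x.H, (∀ i (μ : x.vertex i ⟶ a), g (x.basisElt i μ) = x.ξ i (μ ≫ l)) ∧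
      Orthonormal ℂ g := by
  choose i μ h using fun h : x.basisSet a => h.2
  have hg : ∀ j (ν : x.vertex j ⟶ a), x.ξ (i (x.basisElt j ν)) (μ (x.basisElt j ν) ≫ l) =
      x.ξ j (ν ≫ l) := fun j ν => by
    have h1 := h (x.basisElt j ν)
    rw [← inner_eq_one_iff_of_norm_eq_one (𝕜 := ℂ) (x.norm_ξ _ _) (x.norm_ξ _ _), inner_ξ_comp, h1]
    exact (inner_eq_one_iff_of_norm_eq_one (x.norm_ξ _ _) (x.norm_ξ _ _)).2 rfl
  refine ⟨fun h => x.ξ (i h) (μ h ≫ l), hg, fun h => x.norm_ξ _ _, fun h₁ h₂ hne => ?_⟩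
  obtain ⟨j, ν, rfl⟩ := x.basisSet_cases h₁
  obtain ⟨j', ν', rfl⟩ := x.basisSet_cases h₂
  simp only [hg, inner_ξ_comp]
  exact x.inner_ξ_eq_zero_of_ne _ _ _ _ fun h => hne (Subtype.ext h)

/-- The operator is $WV^*$, where $V$ and $W$ are the isometries on $\ell^2$ of `basisSet a` given
by inclusion and by prefixing with `l`. The factor $V^*$ kills vectors whose range is not `a`. -/
theorem exists_prefixing_operator {a b : Λ} (l : a ⟶ b) : ∃ T : x.H →L[ℂ] x.H,
    (∀ i (μ : x.vertex i ⟶ a), T (x.ξ i μ) = x.ξ i (μ ≫ l)) ∧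
    ∀ i w (μ : x.vertex i ⟶ w), w ≠ a → T (x.ξ i μ) = 0 := by
  classical
  obtain ⟨g, hg, hgo⟩ := x.exists_orthonormal_prefix l
  -- Prefixing by the identity gives the inclusion family.
  obtain ⟨g₀, hg₀, hgo₀⟩ := x.exists_orthonormal_prefix (𝟙 a)
  let W := hgo.orthogonalFamily.linearIsometry
  let V := hgo₀.orthogonalFamily.linearIsometry
  have hW : ∀ i (μ : x.vertex i ⟶ a), W (lp.single 2 (x.basisElt i μ) 1) = x.ξ i (μ ≫ l) :=
    fun i μ => by
      rw [OrthogonalFamily.linearIsometry_apply_single]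
      simp [hg]
  have hV : ∀ i (μ : x.vertex i ⟶ a), V (lp.single 2 (x.basisElt i μ) 1) = x.ξ i μ :=
    fun i μ => by
      rw [OrthogonalFamily.linearIsometry_apply_single]
      simp [hg₀]
  refine ⟨W.toContinuousLinearMap ∘L ContinuousLinearMap.adjoint V.toContinuousLinearMap,
    fun i μ => ?_, fun i w μ hw => ?_⟩
  · have h : ContinuousLinearMap.adjoint V.toContinuousLinearMap (x.ξ i μ) =
        lp.single 2 (x.basisElt i μ) 1 := by
      rw [← hV]
      refine ext_inner_left ℂ fun v => ?_
      rw [ContinuousLinearMap.adjoint_inner_right]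
      exact V.inner_map_map _ _
    rw [ContinuousLinearMap.comp_apply, h]
    exact hW i μ
  · have h : ContinuousLinearMap.adjoint V.toContinuousLinearMap (x.ξ i μ) = 0 := by
      ext h
      obtain ⟨j, ν, rfl⟩ := x.basisSet_cases h
      -- The coordinates of $V^*[\xi^i_\mu]$ are inner products with basis vectors of range `a`,
      -- which are orthogonal to $[\xi^i_\mu]$.
      have h1 := lp.inner_single_left (𝕜 := ℂ) (G := fun _ : x.basisSet a => ℂ)
        (x.basisElt j ν) 1 (ContinuousLinearMap.adjoint V.toContinuousLinearMap (x.ξ i μ))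
      rw [ContinuousLinearMap.adjoint_inner_right] at h1
      change inner ℂ (V _) _ = _ at h1
      rw [hV, x.inner_ξ_of_ne j i hw.symm] at h1
      simpa using h1.symm
    rw [ContinuousLinearMap.comp_apply, h, map_zero]

theorem exists_isPrefixing : ∃ T : ∀ ⦃a b : Λ⦄, (a ⟶ b) → (x.H →L[ℂ] x.H), x.IsPrefixing T := by
  choose T h₁ h₂ using fun (a b : Λ) (l : a ⟶ b) => x.exists_prefixing_operator l
  exact ⟨T, fun a b l => h₁ a b l, fun a b l => h₂ a b l⟩

variable {x}

theorem IsPrefixing.unique {T T' : ∀ ⦃a b : Λ⦄, (a ⟶ b) → (x.H →L[ℂ] x.H)}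
    (hT : x.IsPrefixing T) (hT' : x.IsPrefixing T') : T' = T := by
  funext a b l
  refine x.clm_ext fun i w μ => ?_
  by_cases h : w = a
  · subst h
    rw [hT.1, hT'.1]
  · rw [hT.2 _ _ _ _ h, hT'.2 _ _ _ _ h]

variable (x)

theorem eq_of_inner_ξ {h h' : x.H}
    (H : ∀ i w (μ : x.vertex i ⟶ w), inner ℂ h (x.ξ i μ) = (inner ℂ h' (x.ξ i μ) : ℂ)) :
    h = h' := by
  have : innerSL ℂ h = innerSL ℂ h' := x.clm_ext H
  exact ext_inner_right ℂ fun v => congrArg (fun L : x.H →L[ℂ] ℂ => L v) this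

/-- A $k$-graph is countable, so there are countably many basis vectors; nothing nonzero is
orthogonal to all of them. -/
theorem separableSpace_H : TopologicalSpace.SeparableSpace x.H := by
  have : Countable Λ := CountableCategory.countableObj
  have : ∀ a b : Λ, Countable (a ⟶ b) := CountableCategory.countableHom
  let S : Set x.H := Set.range fun p : (Σ i : ℕ, x.F i) => x.ξ p.1 p.2.2
  have hS : S.Countable := Set.countable_range _
  have hd : (Submodule.span ℂ S).topologicalClosure = ⊤ := by
    rw [Submodule.topologicalClosure_eq_top_iff, Submodule.eq_bot_iff]
    intro v hv
    refine x.eq_of_inner_ξ fun i w μ => ?_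
    rw [inner_zero_left]
    exact Submodule.inner_left_of_mem_orthogonal
      (Submodule.subset_span (Set.mem_range_self (⟨i, w, μ⟩ : Σ i : ℕ, x.F i))) hv
  have hsep := (hS.isSeparable.span (R := ℂ)).closure
  rw [← Submodule.topologicalClosure_coe, hd] at hsep
  exact TopologicalSpace.isSeparable_univ_iff.1 hsep

end InfinitePath
end KGraph

/-! ### The grading of $\mathcal{H}_x$, the Cuntz–Krieger relations and injectivity -/

namespace KGraph
namespace InfinitePath

variable {k : ℕ} {Λ : Type u} [Category.{v} Λ] [KGraph k Λ] (x : InfinitePath Λ)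

theorem deg_segment {i j : ℕ} (h : i ≤ j) (c : Fin k) : deg (x.segment h) c = j - i := by
  exact congrFun (x.deg_map (q := diag k j) (p := diag k i) ⟨fun _ => h⟩) c

/-- The degree `d(μ) - (i, …, i)` of the basis vector `[ξ^i_μ]`. -/
def degξ (i : ℕ) {w : Λ} (μ : x.vertex i ⟶ w) (c : Fin k) : ℤ := deg μ c - i

theorem degξ_segment {i j : ℕ} (h : i ≤ j) {w : Λ} (μ : x.vertex i ⟶ w) :
    x.degξ j (x.segment h ≫ μ) = x.degξ i μ := by
  funext c
  simp only [degξ, deg_comp, Pi.add_apply, deg_segment]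
  omega

theorem degξ_comp (i : ℕ) {a b : Λ} (μ : x.vertex i ⟶ a) (l : a ⟶ b) (c : Fin k) :
    x.degξ i (μ ≫ l) c = deg l c + x.degξ i μ c := by
  simp only [degξ, deg_comp, Pi.add_apply]
  omega

/-- At a common stage, nonzero inner product means equal paths. Thus the degree depends only on the
vector, and different degrees are orthogonal. -/
theorem degξ_eq_of_inner_ne_zero {i j : ℕ} {w w' : Λ} {μ : x.vertex i ⟶ w} {ν : x.vertex j ⟶ w'}
    (h : inner ℂ (x.ξ i μ) (x.ξ j ν) ≠ (0 : ℂ)) : x.degξ i μ = x.degξ j ν := by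
  classical
  rw [← x.ξ_segment (le_max_left i j), ← x.ξ_segment (le_max_right i j), inner_ξ] at h
  have h' := (ite_ne_right_iff.1 h).1
  rw [← x.degξ_segment (le_max_left i j), ← x.degξ_segment (le_max_right i j)]
  obtain rfl : w = w' := congrArg Sigma.fst h'
  simp only [Sigma.mk.injEq, heq_eq_eq, true_and] at h'
  rw [h']

/-- Every basis vector is of the form `[ξ^N_{pγ}]` with `d(p) = n`. -/
theorem exists_ξ_eq_comp (n : Fin k → ℕ) (i : ℕ) {w : Λ} (μ : x.vertex i ⟶ w) :
    ∃ (N : ℕ) (a : Λ) (γ : x.vertex N ⟶ a) (p : a ⟶ w), deg p = n ∧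
      x.ξ i μ = x.ξ N (γ ≫ p) := by
  -- Appending a segment of length $\sum_c n_c$ raises every coordinate of the degree by at least
  -- $n_c$.
  have hle : i ≤ i + ∑ c, n c := Nat.le_add_right _ _
  have hn : n ≤ deg (x.segment hle ≫ μ) := fun c => by
    rw [deg_comp, Pi.add_apply, deg_segment, Nat.add_sub_cancel_left]
    exact (Finset.single_le_sum (fun _ _ => Nat.zero_le _) (Finset.mem_univ c)).trans
      (Nat.le_add_left _ _)
  obtain ⟨⟨a, γ, p⟩, ⟨hp, -, h⟩, -⟩ := KGraph.factorization (x.segment hle ≫ μ) n _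
    (add_tsub_cancel_of_le hn).symm
  exact ⟨_, a, γ, p, hp, by rw [h, ξ_segment]⟩

namespace IsPrefixing

variable {x} {T : ∀ ⦃a b : Λ⦄, (a ⟶ b) → (x.H →L[ℂ] x.H)}

theorem star_apply_comp (hT : x.IsPrefixing T) {a b : Λ} (l : a ⟶ b) (i : ℕ)
    (μ : x.vertex i ⟶ a) : star (T l) (x.ξ i (μ ≫ l)) = x.ξ i μ := by
  refine x.eq_of_inner_ξ fun j w ν => ?_
  rw [ContinuousLinearMap.star_eq_adjoint, ContinuousLinearMap.adjoint_inner_left]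
  by_cases h : w = a
  · subst h
    rw [hT.1, inner_ξ_comp]
  · rw [hT.2 _ _ _ _ h, inner_zero_right, x.inner_ξ_of_ne _ _ (Ne.symm h)]

theorem star_apply_of_range_ne (hT : x.IsPrefixing T) {a b w : Λ} (l : a ⟶ b) (i : ℕ)
    (μ : x.vertex i ⟶ w) (h : w ≠ b) : star (T l) (x.ξ i μ) = 0 := by
  refine x.eq_of_inner_ξ fun j w' ν => ?_
  rw [ContinuousLinearMap.star_eq_adjoint, ContinuousLinearMap.adjoint_inner_left, inner_zero_left]
  by_cases h' : w' = a
  · subst h'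
    rw [hT.1, x.inner_ξ_of_ne _ _ h]
  · rw [hT.2 _ _ _ _ h', inner_zero_right]

/-- A nonzero coefficient would give one path two factorizations with left factors `l` and `l'` of
the same degree, forcing them to be equal. -/
theorem star_apply_comp_of_ne (hT : x.IsPrefixing T) {a a' b : Λ} (l : a ⟶ b) (l' : a' ⟶ b)
    (hd : deg l = deg l') (hne : (⟨a, l⟩ : Σ a, a ⟶ b) ≠ ⟨a', l'⟩) (i : ℕ)
    (μ : x.vertex i ⟶ a') : star (T l) (x.ξ i (μ ≫ l')) = 0 := by
  classical
  refine x.eq_of_inner_ξ fun j w ν => ?_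
  rw [ContinuousLinearMap.star_eq_adjoint, ContinuousLinearMap.adjoint_inner_left, inner_zero_left]
  by_cases h' : w = a
  · subst h'
    rw [hT.1, ← x.ξ_segment (le_max_left i j), ← x.ξ_segment (le_max_right i j), inner_ξ, if_neg]
    intro h
    simp only [Sigma.mk.injEq, heq_eq_eq, true_and, ← Category.assoc] at h
    have h2 := factorization_unique h hd.symm
    exact hne (congrArg (fun q : Σ c : Λ, (x.vertex (max i j) ⟶ c) × (c ⟶ b) =>
      (⟨q.1, q.2.2⟩ : Σ a, a ⟶ b)) h2).symm
  · rw [hT.2 _ _ _ _ h', inner_zero_right]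

/-- Lengthen $\mu$ along $x$ until it has a left factor of degree $d(l)$: if that factor is `l` it
is stripped off, and otherwise the adjoint gives $0$. -/
theorem star_apply_cases (hT : x.IsPrefixing T) {a b w : Λ} (l : a ⟶ b) (i : ℕ)
    (μ : x.vertex i ⟶ w) : star (T l) (x.ξ i μ) = 0 ∨ ∃ (N : ℕ) (γ : x.vertex N ⟶ a),
      star (T l) (x.ξ i μ) = x.ξ N γ ∧ ∀ c, x.degξ i μ c = deg l c + x.degξ N γ c := by
  by_cases h : w = b
  swap
  · exact Or.inl (hT.star_apply_of_range_ne l i μ h)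
  subst h
  obtain ⟨N, a', γ, p, hp, hμ⟩ := x.exists_ξ_eq_comp (deg l) i μ
  by_cases hne : (⟨a, l⟩ : Σ a, a ⟶ w) = ⟨a', p⟩
  · cases hne
    refine Or.inr ⟨N, γ, by rw [hμ, hT.star_apply_comp], fun c => ?_⟩
    rw [← degξ_comp]
    refine congrFun (x.degξ_eq_of_inner_ne_zero ?_) c
    rw [hμ, inner_ξ_comp, inner_self_ne_zero, ← norm_ne_zero_iff, norm_ξ]
    exact one_ne_zero
  · left
    rw [hμ, hT.star_apply_comp_of_ne l p hp.symm hne]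

/-- The prefixing operators form a Cuntz-Krieger family. -/
theorem isCuntzKriegerFamily [RowFinite Λ] (hT : x.IsPrefixing T) : IsCuntzKriegerFamily T := by
  have hid : ∀ {w w' : Λ} (i : ℕ) (μ : x.vertex i ⟶ w), w = w' → T (𝟙 w') (x.ξ i μ) = x.ξ i μ :=
    fun {w w'} i μ h => by
      subst h
      rw [hT.1, Category.comp_id]
  have hmul : ∀ {a b c : Λ} (ν : a ⟶ b) (μ : b ⟶ c), T μ * T ν = T (ν ≫ μ) := fun {a b c} ν μ => by
    refine x.clm_ext fun i w γ => ?_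
    rw [mul_apply_eq_comp]
    by_cases h : w = a
    · subst h
      rw [hT.1, hT.1, hT.1, Category.assoc]
    · rw [hT.2 _ _ _ _ h, hT.2 _ _ _ _ h, map_zero]
  have hstar_mul : ∀ {a b : Λ} (l : a ⟶ b), star (T l) * T l = T (𝟙 a) := fun {a b} l => by
    refine x.clm_ext fun i w γ => ?_
    rw [mul_apply_eq_comp]
    by_cases h : w = a
    · subst h
      rw [hT.1, hT.star_apply_comp, hid _ _ rfl]
    · rw [hT.2 _ _ _ _ h, hT.2 _ _ _ _ h, map_zero]
  have hmul_id : ∀ {a b : Λ} (l : a ⟶ b), T l * T (𝟙 a) = T l := fun l => by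
    rw [hmul, Category.id_comp]
  intro y z h
  cases h with
  | partial_isometry l => rw [mul_assoc, hstar_mul, hmul_id]
  | vertex_star w =>
    -- A vertex operator has the form $S^*S$, hence is self-adjoint.
    rw [← hstar_mul (𝟙 w), star_mul, star_star]
  | vertex_idem w => exact hmul_id _
  | @vertex_orth w w' h =>
    refine x.clm_ext fun i c γ => ?_
    rw [mul_apply_eq_comp, zero_apply]
    by_cases h' : c = w'
    · rw [hid _ _ h', hT.2 _ _ _ _ fun h'' => h (h''.symm.trans h')]
    · rw [hT.2 _ _ _ _ h', map_zero]
  | mul ν μ => exact hmul ν μ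
  | star_mul l => exact hstar_mul l
  | sum w n =>
    refine x.clm_ext fun i c γ => ?_
    rw [sum_apply]
    simp only [mul_apply_eq_comp]
    by_cases h : c = w
    · subst h
      -- Once the vector is written with a left factor `p` of degree $n$, only the summand of `p`
      -- survives.
      obtain ⟨N, a, δ, p, hp, hγ⟩ := x.exists_ξ_eq_comp n i γ
      rw [hid _ _ rfl, hγ, Finset.sum_eq_single ⟨a, p⟩]
      · rw [hT.star_apply_comp, hT.1]
      · rintro ⟨a', q⟩ hq hne
        have hq' : deg q = n := by simpa [pathsInto] using hq
        rw [hT.star_apply_comp_of_ne q p (hq'.trans hp.symm) hne, map_zero]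
      · intro hp'
        exact absurd (by simpa [pathsInto] using hp) hp'
    · rw [hT.2 _ _ _ _ h, Finset.sum_eq_zero]
      rintro p -
      rw [hT.star_apply_of_range_ne _ _ _ h, map_zero]

/-- Strong connectedness provides a path from $v_0$ to $w$, and $T_w$ fixes the corresponding unit
vector. -/
theorem map_id_ne_zero (hΛ : StronglyConnected Λ) (hT : x.IsPrefixing T) (w : Λ) :
    T (𝟙 w) ≠ 0 := by
  intro h
  obtain ⟨μ⟩ := hΛ w (x.vertex 0)
  have h1 := hT.1 (𝟙 w) 0 μ
  rw [h, Category.comp_id] at h1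
  have h2 := x.norm_ξ 0 μ
  rw [← h1] at h2
  simp at h2

/-- The matrix coefficients of `π(y)` for `y` in a spectral subspace of the gauge action. -/
theorem inner_spectralPart [RowFinite Λ] (hT : x.IsPrefixing T)
    {π : CStar Λ →⋆ₙₐ[ℂ] (x.H →L[ℂ] x.H)} (hπ : ∀ ⦃a b : Λ⦄ (l : a ⟶ b), π (univ l) = T l)
    (n : Fin k → ℤ) (y : CStar Λ) {i j : ℕ} {w w' : Λ} (μ : x.vertex i ⟶ w)
    (ν : x.vertex j ⟶ w') : inner ℂ (x.ξ i μ) (π (spectralPart n y) (x.ξ j ν)) =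
      if x.degξ i μ - x.degξ j ν = n then inner ℂ (x.ξ i μ) (π y (x.ξ j ν)) else (0 : ℂ) := by
  let P : CStar Λ →L[ℂ] (x.H →L[ℂ] x.H) :=
    ⟨(π : CStar Λ →ₗ[ℂ] (x.H →L[ℂ] x.H)), continuous_nonUnitalStarAlgHom π⟩
  let L : CStar Λ →L[ℂ] ℂ :=
    (innerSL ℂ (x.ξ i μ)) ∘L (ContinuousLinearMap.apply ℂ x.H (x.ξ j ν)) ∘L P
  -- Both sides are continuous and linear in $y$, so the products $t_\alpha t_\beta^*$ suffice. For
  -- these, a nonzero coefficient forces the degree difference of the two vectors to be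
  -- $d(\alpha)-d(\beta)$, so the two conditions agree.
  have key : L ∘L spectralPart n = (if x.degξ i μ - x.degξ j ν = n then (1 : ℂ) else 0) • L := by
    refine eq_of_forall_mul_star fun {e a b} α β => ?_
    have hL : L (univ α * star (univ β)) = inner ℂ (x.ξ i μ) (T α (star (T β) (x.ξ j ν))) := by
      change inner ℂ (x.ξ i μ) (π (univ α * star (univ β)) (x.ξ j ν)) = _
      rw [map_mul, map_star, hπ, hπ]; rfl
    have hdeg : L (univ α * star (univ β)) ≠ 0 →
        x.degξ i μ - x.degξ j ν = fun c => (deg α c : ℤ) - deg β c := fun h => by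
      rw [hL] at h
      rcases hT.star_apply_cases β j ν with h0 | ⟨N, γ, hγ, hd⟩
      · rw [h0, map_zero, inner_zero_right] at h
        exact absurd rfl h
      · rw [hγ, hT.1] at h
        funext c
        have h1 := congrFun (x.degξ_eq_of_inner_ne_zero h) c
        rw [degξ_comp] at h1
        rw [Pi.sub_apply, h1, hd c]
        ring
    rw [ContinuousLinearMap.comp_apply, spectralPart_mul_star, smul_apply]
    by_cases h0 : L (univ α * star (univ β)) = 0
    · rw [apply_ite L, h0, map_zero, ite_self, smul_zero]
    · rw [hdeg h0]
      split_ifs <;> simp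
  have := congrArg (fun M : CStar Λ →L[ℂ] ℂ => M y) key
  change inner ℂ (x.ξ i μ) (π (spectralPart n y) (x.ξ j ν)) =
    (if x.degξ i μ - x.degξ j ν = n then (1 : ℂ) else 0) •
      inner ℂ (x.ξ i μ) (π y (x.ξ j ν)) at this
  rw [this, ite_smul, one_smul, zero_smul]

/-- If $\pi(y)=0$, every matrix coefficient of $\pi$ at a spectral part of $y$ is either $0$ or a
coefficient of $\pi(y)$, so the kernel is graded. -/
theorem injective [RowFinite Λ] (hΛ : StronglyConnected Λ) (hT : x.IsPrefixing T)
    {π : CStar Λ →⋆ₙₐ[ℂ] (x.H →L[ℂ] x.H)} (hπ : ∀ ⦃a b : Λ⦄ (l : a ⟶ b), π (univ l) = T l) :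
    Function.Injective π := by
  refine injective_of_spectralPart π (fun w => hπ (𝟙 w) ▸ hT.map_id_ne_zero hΛ w)
    fun y hy n => x.clm_ext fun j w ν => x.eq_of_inner_ξ fun i w' μ => ?_
  rw [← inner_conj_symm, hT.inner_spectralPart hπ, hy]
  simp

end IsPrefixing
end InfinitePath
end KGraph

theorem mainTheorem3 {k : ℕ} (Λ : Type u) [Category.{v} Λ] [KGraph k Λ] [KGraph.RowFinite Λ]
    (hΛ : KGraph.StronglyConnected Λ) (x : KGraph.InfinitePath Λ) :
    TopologicalSpace.SeparableSpace x.H ∧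
    ∃ T : ∀ ⦃a b : Λ⦄, (a ⟶ b) → (x.H →L[ℂ] x.H),
      x.IsPrefixing T ∧ (∀ T', x.IsPrefixing T' → T' = T) ∧
      KGraph.IsCuntzKriegerFamily T ∧
      ∃ π : KGraph.CStar Λ →⋆ₙₐ[ℂ] (x.H →L[ℂ] x.H),
        (∀ ⦃a b : Λ⦄ (l : a ⟶ b), π (KGraph.univ l) = T l) ∧
        (∀ π' : KGraph.CStar Λ →⋆ₙₐ[ℂ] (x.H →L[ℂ] x.H),
          (∀ ⦃a b : Λ⦄ (l : a ⟶ b), π' (KGraph.univ l) = T l) → π' = π) ∧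
        Function.Injective π := by
  obtain ⟨T, hT⟩ := x.exists_isPrefixing
  obtain ⟨π, hπ, huniq⟩ := KGraph.existsUnique_lift T hT.isCuntzKriegerFamily
  exact ⟨x.separableSpace_H, T, hT, fun T' hT' => hT.unique hT', hT.isCuntzKriegerFamily, π, hπ,
    huniq, hT.injective hΛ hπ⟩
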